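/- Let $0<p<1$ and put $p_\#=\frac{p}{1-p}$. Let $\{\xi_k\}_{k\ge0}$ and $\{\eta_k\}_{k\ge0}$ be sequences of positive integers with $\xi_k\le\eta_k$ for all $k$ and $$\sum_{k\ge1}\left(\frac{\eta_k-\xi_k+\eta_{k-1}}{\eta_k}\right)^{2/p_\#}<\infty .$$ Let $\psi(z)=\sum_{j\ge0}\hat\psi(j)z^j$ be a function analytic in the unit disk $\mathbb D$ such that $\hat\psi(j)=0$ for $j\notin\bigcup_{k\ge0}[\xi_k,\eta_k)$. If $\psi$ belongs to the Besov class $B^{1/p_\#}_{p\,p_\#}$, then the Hankel matrix $\Gamma_\psi=\{\hat\psi(j+k)\}_{j,k\ge0}$ is a Schur multiplier of the Schatten--von Neumann class $S_p$ of operators on $\ell^2$ (that is, $\Gamma_\psi\in\mathfrak M_p$): for every $B=\{b_{jk}\}_{j,k\ge0}\in S_p$ the matrix $\{\hat\psi(j+k)\,b_{jk}\}_{j,k\ge0}$ is the matrix of an operator of class $S_p$. Here $\psi\in B^{s}_{p\,q}$ means that $\{2^{ns}\|\psi*V_n\|_{L^p(\mathbb T)}\}_{n\ge0}\in\ell^q$,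 where $\psi*V_0=\hat\psi(0)+\hat\psi(1)z$ and $\psi*V_n=\sum_{k\ge0}v(k/2^n)\hat\psi(k)z^k$ for $n\ge1$, $L^p(\mathbb T)$ is taken with respect to normalized Lebesgue measure, and $v\ge0$ is any $C^\infty$ function on $\mathbb R$ with $\operatorname{supp}v=[1/2,2]$ and $\sum_{n\ge0}v(x/2^n)=1$ for $x\ge1$. -/

import Mathlib

open scoped ENNReal ContDiff Matrix

noncomputable section

/-- The complex Hilbert space `ℓ²` of square summable sequences indexed by `0, 1, 2, …`. -/
abbrev EllTwo : Type := lp (fun _ : ℕ => ℂ) 2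

/-- The matrix of a bounded operator on `ℓ²` in the standard orthonormal basis: the `(j, k)` entry
is the `j`-th coordinate of `T e_k`. -/
def matrixOf (T : EllTwo →L[ℂ] EllTwo) : Matrix ℕ ℕ ℂ :=
  Matrix.of fun j k => T (lp.single 2 k (1 : ℂ)) j

/-- The `n`-th singular value (`n ≥ 0`) of a bounded operator on `ℓ²`: its distance in operator norm
to the set of operators of rank at most `n`. -/
def singularNumber (T : EllTwo →L[ℂ] EllTwo) (n : ℕ) : ℝ :=
  ⨅ R : {R : EllTwo →L[ℂ] EllTwo // (R : EllTwo →ₗ[ℂ] EllTwo).rank ≤ (n : Cardinal)},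
    ‖T - (R : EllTwo →L[ℂ] EllTwo)‖

/-- Membership in the Schatten–von Neumann class `S_p`, `0 < p < ∞`: the singular values are
`p`-summable (in particular they tend to `0`, so that the operator is compact). -/
def MemSchatten (p : ℝ) (T : EllTwo →L[ℂ] EllTwo) : Prop :=
  Summable fun n : ℕ => singularNumber T n ^ p

/-- `A` is a Schur multiplier of `S_p` (that is, `A ∈ 𝔐_p`): for every operator `B` of class `S_p`,
the Schur product of `A` with the matrix of `B` is the matrix of an operator of class `S_p`. -/
def IsSchurMultiplier (p : ℝ) (A : Matrix ℕ ℕ ℂ) : Prop :=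
  ∀ B : EllTwo →L[ℂ] EllTwo, MemSchatten p B →
    ∃ C : EllTwo →L[ℂ] EllTwo, MemSchatten p C ∧ matrixOf C = A ⊙ matrixOf B

/-- The `j`-th Taylor coefficient at the origin. -/
def taylorCoeff (ψ : ℂ → ℂ) (j : ℕ) : ℂ :=
  iteratedDeriv j ψ 0 / (j.factorial : ℂ)

/-- The Hankel matrix `Γ_ψ` with entries `ψ̂(j + k)`. -/
def hankelMatrix (ψ : ℂ → ℂ) : Matrix ℕ ℕ ℂ :=
  Matrix.of fun j k => taylorCoeff ψ (j + k)

/-- The functions `v` that generate the dyadic decomposition of the frequencies. -/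
structure IsDyadicWindow (v : ℝ → ℝ) : Prop where
  contDiff : ContDiff ℝ ∞ v
  nonneg : ∀ x, 0 ≤ v x
  tsupport_eq : tsupport v = Set.Icc (1 / 2) 2
  hasSum_one : ∀ x : ℝ, 1 ≤ x → HasSum (fun n : ℕ => v (x / 2 ^ n)) 1

/-- The `k`-th Fourier coefficient, `k ≥ 0`, of the kernel `V_n`, `n ≥ 0`:
`V_0(z) = z̄ + 1 + z` and `V_n(z) = ∑_{k ≥ 0} v(k / 2ⁿ) zᵏ` for `n ≥ 1`. -/
def kernelCoeff (v : ℝ → ℝ) (n k : ℕ) : ℝ :=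
  if n = 0 then (if k ≤ 1 then 1 else 0) else v (k / 2 ^ n)

/-- The trigonometric polynomial `ψ * V_n`, `n ≥ 0`, on the unit circle `ℝ / ℤ` (with `z` the
function `t ↦ exp (2 π i t)`), for `ψ` analytic in the unit disk. The coefficients
`kernelCoeff v n k` vanish for `k > 2 ^ (n + 1)`, so the finite sum is the whole series. -/
def dyadicBlock (v : ℝ → ℝ) (ψ : ℂ → ℂ) (n : ℕ) (t : UnitAddCircle) : ℂ :=
  ∑ k ∈ Finset.range (2 ^ (n + 1) + 1),
    (kernelCoeff v n k : ℂ) * taylorCoeff ψ k * fourier (k : ℤ) t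

/-- Membership of a function `ψ` analytic in the unit disk in the Besov class `B^s_{p q}`: the
sequence `2^{n s} ‖ψ * V_n‖_{L^p}`, `n ≥ 0`, belongs to `ℓ^q`. The `L^p` (quasi)norm is taken with
respect to normalized Lebesgue measure on the circle. For analytic `ψ` the terms with `n < 0` of
the two-sided definition vanish. -/
def MemBesov (v : ℝ → ℝ) (s : ℝ) (p q : ℝ≥0∞) (ψ : ℂ → ℂ) : Prop :=
  Memℓp (fun n : ℕ =>
    (2 : ℝ) ^ ((n : ℝ) * s) *
      (MeasureTheory.eLpNorm (dyadicBlock v ψ n) p AddCircle.haarAddCircle).toReal) q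

end

/-! ### Elements of `ℓ²` -/

namespace EllTwo

/-! For `p < 1`, operators of class `S_p` are exactly the `p`-summable sums of rank one operators
(`MemSchatten.exists_nucLE`, `NucLE.exists_memSchatten`). A matrix is therefore a Schur multiplier
as soon as it sends each `x ⊗ y` to such a sum of cost at most `M (‖x‖ ‖y‖) ^ p`; this is `SchurLE`,
and every estimate below is made for it.

The basic estimate is `schurLE_hankelBlock`. On a block where the frequencies of the symbol `f`
differ from `i + j` by less than `N`, discrete Fourier inversion at `N` equally spaced points writes
the coefficient as an average of `f (z_l) z_l ^ (-(i + j))`. Each summand is a unimodular rank one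
multiplier, and after a suitable rotation of the points the total cost is at most `N ^ (1 - p) ∫ |f|
^ p`.

Convergence of the series in the hypothesis makes the spectral intervals eventually short and
lacunary. With `f_k` the part of `ψ` with spectrum in `[ξ_k, η_k)`, the matrix of `f_k` splits into
a middle square with indices in `[η_{k-1}, η_k)` and two thin corners. The squares have disjoint
rows and columns, so Hölder's inequality asks for costs in `ℓ^{1/(1-p)}`; with `N = 2 η_k` this is
the Besov condition. The corners only have disjoint columns (or rows), which asks for the stronger
`ℓ^{2/(2-p)}`; but there `N = η_k - ξ_k + η_{k-1}` suffices, and the gain `(N / η_k) ^ (1 - p)` is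
what the hypothesis on the intervals pays for, through Young's inequality.

Finally, each late `f_k` is exactly a sum of three consecutive dyadic blocks of `ψ`, because the
windows sum to `1` on its interval and reach no other interval. Thus `∫ |f_k| ^ p` is controlled
without any multiplier theorem in `L^p`. The finitely many early frequencies form a finite matrix.
-/

theorem enorm_sq_eq_tsum (x : EllTwo) : ‖x‖ₑ ^ 2 = ∑' j, ‖x j‖ₑ ^ 2 := by
  have h := lp.hasSum_norm (p := 2) (by norm_num) x
  simp only [ENNReal.toReal_ofNat, Real.rpow_two] at h
  have h2 := h.tsum_eq
  rw [← ofReal_norm, ← ENNReal.ofReal_pow (norm_nonneg _), ← h2,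
    ENNReal.ofReal_tsum_of_nonneg (fun _ => by positivity) h.summable]
  refine tsum_congr fun j => ?_
  rw [ENNReal.ofReal_pow (norm_nonneg _), ofReal_norm]

theorem enorm_le_of_sq_le {a b : ℝ≥0∞} (h : a ^ 2 ≤ b ^ 2) : a ≤ b := by
  rwa [ENNReal.pow_le_pow_left_iff (by norm_num)] at h

/-- Pointwise multiplication by a sequence bounded by `1`. -/
noncomputable def mul (u : ℕ → ℂ) (hu : ∀ j, ‖u j‖ ≤ 1) (x : EllTwo) : EllTwo :=
  ⟨fun j => u j * x j, Memℓp.mono' (F := fun _ => ℂ) (f := fun j => u j * x j) (lp.memℓp x)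
    fun j => by
    rw [norm_mul]
    exact mul_le_of_le_one_left (norm_nonneg _) (hu j)⟩

@[simp] theorem mul_apply (u : ℕ → ℂ) (hu : ∀ j, ‖u j‖ ≤ 1) (x : EllTwo) (j : ℕ) :
    mul u hu x j = u j * x j := rfl

theorem enorm_mul_le (u : ℕ → ℂ) (hu : ∀ j, ‖u j‖ ≤ 1) (x : EllTwo) : ‖mul u hu x‖ₑ ≤ ‖x‖ₑ := by
  apply enorm_le_of_sq_le
  rw [enorm_sq_eq_tsum, enorm_sq_eq_tsum]
  refine ENNReal.tsum_le_tsum fun j => ?_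
  gcongr
  rw [mul_apply, enorm_mul]
  calc ‖u j‖ₑ * ‖x j‖ₑ ≤ 1 * ‖x j‖ₑ := by
        gcongr
        rw [← ofReal_norm]
        exact ENNReal.ofReal_le_one.2 (hu j)
    _ = ‖x j‖ₑ := one_mul _

open Classical in
/-- The restriction of a square summable sequence to a set of indices. -/
noncomputable def restrict (I : Set ℕ) (x : EllTwo) : EllTwo :=
  mul (fun j => if j ∈ I then 1 else 0) (fun j => by split_ifs <;> simp) x

theorem restrict_apply_of_mem {I : Set ℕ} (x : EllTwo) {j : ℕ} (hj : j ∈ I) :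
    restrict I x j = x j := by
  simp [restrict, hj]

theorem tsum_enorm_restrict_sq_le {ι : Type*} {I : ι → Set ℕ}
    (hI : Pairwise (Function.onFun Disjoint I)) (x : EllTwo) :
    ∑' l, ‖restrict (I l) x‖ₑ ^ 2 ≤ ‖x‖ₑ ^ 2 := by
  classical
  simp only [enorm_sq_eq_tsum]
  rw [ENNReal.tsum_comm]
  refine ENNReal.tsum_le_tsum fun j => ?_
  by_cases h : ∃ l, j ∈ I l
  · obtain ⟨l, hl⟩ := h
    rw [tsum_eq_single l]
    · rw [restrict_apply_of_mem _ hl]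
    · intro l' hne
      have : j ∉ I l' := fun h' => (Set.disjoint_left.1 (hI hne) h') hl
      simp [restrict, this]
  · push Not at h
    simp [restrict, h]

end EllTwo

/-! ### Sums of rank one matrices -/

/-- The matrix `a` is a sum of rank one matrices `x i ⊗ y i` with
`∑ (‖x i‖ ‖y i‖) ^ p ≤ c`. -/
def NucLE (p : ℝ) (a : ℕ → ℕ → ℂ) (c : ℝ≥0∞) : Prop :=
  ∃ x y : ℕ → EllTwo, (∀ j k, HasSum (fun i => x i j * y i k) (a j k)) ∧
    ∑' i, (‖x i‖ₑ * ‖y i‖ₑ) ^ p ≤ c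

theorem NucLE.mono {p : ℝ} {a : ℕ → ℕ → ℂ} {c d : ℝ≥0∞} (h : NucLE p a c) (hcd : c ≤ d) :
    NucLE p a d := by
  obtain ⟨x, y, h1, h2⟩ := h
  exact ⟨x, y, h1, h2.trans hcd⟩

theorem nucLE_zero {p : ℝ} (hp : 0 < p) : NucLE p (fun _ _ => 0) 0 :=
  ⟨fun _ => 0, fun _ => 0, fun j k => by simp [hasSum_zero], by simp [hp]⟩

theorem nucLE_rankOne {p : ℝ} (hp : 0 < p) (x y : EllTwo) :
    NucLE p (fun j k => x j * y k) ((‖x‖ₑ * ‖y‖ₑ) ^ p) := by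
  refine ⟨fun i => if i = 0 then x else 0, fun i => if i = 0 then y else 0, fun j k => ?_, ?_⟩
  · have := hasSum_single (f := fun i : ℕ => (if i = 0 then x else 0 : EllTwo) j *
      (if i = 0 then y else 0 : EllTwo) k) 0 (fun i hi => by simp [hi])
    simpa using this
  · rw [tsum_eq_single 0]
    · simp
    · intro i hi
      simp [hi, hp]

/-- For exponents at most `1`, an `ℓᵖ` summable family of extended nonnegative numbers is
summable. -/
theorem ENNReal.rpow_tsum_le_tsum_rpow {ι : Type*} {p : ℝ} (hp0 : 0 < p) (hp1 : p ≤ 1)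
    (f : ι → ℝ≥0∞) : (∑' i, f i) ^ p ≤ ∑' i, f i ^ p := by
  classical
  have hfin : ∀ s : Finset ι, (∑ i ∈ s, f i) ^ p ≤ ∑ i ∈ s, f i ^ p := by
    intro s
    induction s using Finset.induction_on with
    | empty => simp [hp0]
    | insert a s ha ih =>
      rw [Finset.sum_insert ha, Finset.sum_insert ha]
      exact (ENNReal.rpow_add_le_add_rpow _ _ hp0.le hp1).trans (by gcongr)
  have ht : Filter.Tendsto (fun s : Finset ι => (∑ i ∈ s, f i) ^ p) Filter.atTop
      (nhds ((∑' i, f i) ^ p)) :=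
    ((ENNReal.continuous_rpow_const).tendsto _).comp ENNReal.summable.hasSum
  exact le_of_tendsto' ht fun s => (hfin s).trans (ENNReal.sum_le_tsum s)

theorem ENNReal.tsum_ne_top_of_tsum_rpow_ne_top {ι : Type*} {p : ℝ} (hp0 : 0 < p) (hp1 : p ≤ 1)
    {f : ι → ℝ≥0∞} (h : ∑' i, f i ^ p ≠ ⊤) : ∑' i, f i ≠ ⊤ := by
  intro h'
  have := ENNReal.rpow_tsum_le_tsum_rpow hp0 hp1 f
  rw [h', ENNReal.top_rpow_of_pos hp0, top_le_iff] at this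
  exact h this

theorem EllTwo.enorm_apply_le (x : EllTwo) (j : ℕ) : ‖x j‖ₑ ≤ ‖x‖ₑ := by
  rw [← ofReal_norm, ← ofReal_norm]
  exact ENNReal.ofReal_le_ofReal (lp.norm_apply_le_norm (by norm_num) x j)

theorem summable_of_tsum_enorm_ne_top {ι F : Type*} [NormedAddCommGroup F] [CompleteSpace F]
    {f : ι → F} (h : ∑' i, ‖f i‖ₑ ≠ ⊤) : Summable f := by
  apply Summable.of_norm
  have := ENNReal.summable_toReal h
  simpa using this

/-- Countable subadditivity. -/
theorem nucLE_tsum {ι : Type*} [Countable ι] {p : ℝ} (hp0 : 0 < p) (hp1 : p ≤ 1)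
    {A : ι → ℕ → ℕ → ℂ} {c : ι → ℝ≥0∞} {a : ℕ → ℕ → ℂ} (hA : ∀ i, NucLE p (A i) (c i))
    (hc : ∑' i, c i ≠ ⊤) (ha : ∀ j k, HasSum (fun i => A i j k) (a j k)) :
    NucLE p a (∑' i, c i) := by
  choose x y hxy hcost using hA
  have hcost' : ∑' q : ι × ℕ, (‖x q.1 q.2‖ₑ * ‖y q.1 q.2‖ₑ) ^ p ≤ ∑' i, c i := by
    rw [ENNReal.tsum_prod (f := fun i l => (‖x i l‖ₑ * ‖y i l‖ₑ) ^ p)]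
    exact ENNReal.tsum_le_tsum hcost
  have hsum : ∀ j k, HasSum (fun q : ι × ℕ => x q.1 q.2 j * y q.1 q.2 k) (a j k) := by
    intro j k
    have hs : Summable (fun q : ι × ℕ => x q.1 q.2 j * y q.1 q.2 k) := by
      apply summable_of_tsum_enorm_ne_top
      have h1 := ENNReal.tsum_ne_top_of_tsum_rpow_ne_top hp0 hp1 (ne_top_of_le_ne_top hc hcost')
      refine ne_top_of_le_ne_top h1 (ENNReal.tsum_le_tsum fun q => ?_)
      rw [enorm_mul]
      gcongr <;> exact EllTwo.enorm_apply_le _ _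
    have h2 := hs.hasSum
    have h3 := h2.prod_fiberwise (fun i => hxy i j k)
    rwa [h3.unique (ha j k)] at h2
  -- The double family is reindexed by `ℕ`, with zero vectors off the range of the injection `e`.
  obtain ⟨e, he⟩ := exists_injective_nat (ι × ℕ)
  classical
  have hz : ∀ (z : ι → ℕ → EllTwo) q, Function.extend e (fun q : ι × ℕ => z q.1 q.2) 0 (e q) =
      z q.1 q.2 := fun z q => he.extend_apply _ _ _
  have hz' : ∀ (z : ι → ℕ → EllTwo) n, n ∉ Set.range e →
      Function.extend e (fun q : ι × ℕ => z q.1 q.2) 0 n = 0 := fun z n hn =>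
    Function.extend_apply' _ _ _ (by simpa using hn)
  refine ⟨Function.extend e (fun q : ι × ℕ => x q.1 q.2) 0,
    Function.extend e (fun q : ι × ℕ => y q.1 q.2) 0, fun j k => ?_, ?_⟩
  · rw [← he.hasSum_iff]
    · simpa only [Function.comp_def, hz] using hsum j k
    · intro n hn
      simp [hz' _ n hn]
  · refine le_trans (le_of_eq ?_) hcost'
    rw [← he.tsum_eq]
    · simp only [hz]
    · intro n hn
      by_contra h
      simp [hz' _ n h, hp0] at hn

/-! ### Singular numbers -/

theorem bddBelow_singularNumber (T : EllTwo →L[ℂ] EllTwo) (n : ℕ) :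
    BddBelow (Set.range fun R : {R : EllTwo →L[ℂ] EllTwo //
      (R : EllTwo →ₗ[ℂ] EllTwo).rank ≤ (n : Cardinal)} =>
        ‖T - (R : EllTwo →L[ℂ] EllTwo)‖) :=
  ⟨0, by rintro _ ⟨R, rfl⟩; exact norm_nonneg _⟩

instance nonempty_rank_le (n : ℕ) : Nonempty {R : EllTwo →L[ℂ] EllTwo //
    (R : EllTwo →ₗ[ℂ] EllTwo).rank ≤ (n : Cardinal)} :=
  ⟨⟨0, by simp⟩⟩

theorem singularNumber_nonneg (T : EllTwo →L[ℂ] EllTwo) (n : ℕ) : 0 ≤ singularNumber T n :=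
  Real.iInf_nonneg fun _ => norm_nonneg _

theorem singularNumber_le {T R : EllTwo →L[ℂ] EllTwo} {n : ℕ}
    (hR : (R : EllTwo →ₗ[ℂ] EllTwo).rank ≤ (n : Cardinal)) : singularNumber T n ≤ ‖T - R‖ :=
  ciInf_le (bddBelow_singularNumber T n) ⟨R, hR⟩

theorem exists_norm_sub_lt (T : EllTwo →L[ℂ] EllTwo) (n : ℕ) {δ : ℝ} (hδ : 0 < δ) :
    ∃ R : EllTwo →L[ℂ] EllTwo, (R : EllTwo →ₗ[ℂ] EllTwo).rank ≤ (n : Cardinal) ∧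
      ‖T - R‖ < singularNumber T n + δ := by
  obtain ⟨⟨R, hR⟩, h⟩ := exists_lt_of_ciInf_lt (lt_add_of_pos_right (singularNumber T n) hδ)
  exact ⟨R, hR, h⟩

theorem rank_add_le_natCast {A B : EllTwo →L[ℂ] EllTwo} {m n : ℕ}
    (hA : (A : EllTwo →ₗ[ℂ] EllTwo).rank ≤ (m : Cardinal))
    (hB : (B : EllTwo →ₗ[ℂ] EllTwo).rank ≤ (n : Cardinal)) :
    ((A + B : EllTwo →L[ℂ] EllTwo) : EllTwo →ₗ[ℂ] EllTwo).rank ≤ ((m + n : ℕ) : Cardinal) := by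
  rw [ContinuousLinearMap.toLinearMap_add, Nat.cast_add]
  exact (LinearMap.rank_add_le _ _).trans (add_le_add hA hB)

theorem rank_neg_le_natCast {A : EllTwo →L[ℂ] EllTwo} {m : ℕ}
    (hA : (A : EllTwo →ₗ[ℂ] EllTwo).rank ≤ (m : Cardinal)) :
    ((-A : EllTwo →L[ℂ] EllTwo) : EllTwo →ₗ[ℂ] EllTwo).rank ≤ (m : Cardinal) := by
  rw [ContinuousLinearMap.toLinearMap_neg, LinearMap.rank, LinearMap.range_neg]
  exact hA

theorem singularNumber_add_index_le {T R : EllTwo →L[ℂ] EllTwo} {m : ℕ} (n : ℕ)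
    (hR : (R : EllTwo →ₗ[ℂ] EllTwo).rank ≤ (m : Cardinal)) :
    singularNumber T (n + m) ≤ singularNumber (T - R) n := by
  refine le_ciInf fun ⟨Q, hQ⟩ => ?_
  rw [sub_sub, add_comm R]
  exact singularNumber_le (rank_add_le_natCast hQ hR)

theorem singularNumber_antitone (T : EllTwo →L[ℂ] EllTwo) : Antitone (singularNumber T) := by
  intro m n hmn
  refine le_ciInf fun ⟨Q, hQ⟩ => singularNumber_le (hQ.trans ?_)
  exact_mod_cast hmn

theorem singularNumber_le_add (A B : EllTwo →L[ℂ] EllTwo) (n : ℕ) :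
    singularNumber A n ≤ singularNumber B n + ‖A - B‖ := by
  rw [← sub_le_iff_le_add]
  refine le_ciInf fun ⟨Q, hQ⟩ => ?_
  rw [sub_le_iff_le_add]
  calc singularNumber A n ≤ ‖A - Q‖ := singularNumber_le hQ
    _ = ‖(B - Q) + (A - B)‖ := by congr 1; abel
    _ ≤ _ := norm_add_le _ _

theorem continuous_singularNumber (n : ℕ) :
    Continuous fun T : EllTwo →L[ℂ] EllTwo => singularNumber T n := by
  refine LipschitzWith.continuous (K := 1) (LipschitzWith.of_le_add fun A B => ?_)
  rw [dist_eq_norm]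
  exact singularNumber_le_add A B n

/-! ### Operators of class `S_p` are `p`-summable sums of rank one operators -/

theorem matrixOf_apply (T : EllTwo →L[ℂ] EllTwo) (j k : ℕ) :
    matrixOf T j k = T (lp.single 2 k (1 : ℂ)) j := rfl

theorem EllTwo.inner_single_eq (x : EllTwo) (k : ℕ) :
    inner ℂ x (lp.single 2 k (1 : ℂ) : EllTwo) = star x k := by
  rw [lp.inner_single_right]
  simp

/-- Evaluation of a coordinate. -/
noncomputable def EllTwo.coord (j : ℕ) : EllTwo →L[ℂ] ℂ :=
  innerSL ℂ (lp.single 2 j (1 : ℂ) : EllTwo)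

@[simp] theorem EllTwo.coord_apply (j : ℕ) (x : EllTwo) : EllTwo.coord j x = x j := by
  rw [EllTwo.coord, innerSL_apply_apply, lp.inner_single_left]
  simp

/-- The entry of the matrix of an operator is a continuous functional of the operator. -/
noncomputable def matrixEntry (j k : ℕ) : (EllTwo →L[ℂ] EllTwo) →L[ℂ] ℂ :=
  (EllTwo.coord j).comp (ContinuousLinearMap.apply ℂ EllTwo (lp.single 2 k (1 : ℂ) : EllTwo))

@[simp] theorem matrixEntry_apply (j k : ℕ) (T : EllTwo →L[ℂ] EllTwo) :
    matrixEntry j k T = matrixOf T j k := by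
  simp [matrixEntry, matrixOf_apply]

/-- Expanding in an orthonormal basis `b i` of the range gives at most `n` rank one terms, each of
norm at most `‖D‖` because `D* (b i)` is. -/
theorem nucLE_matrixOf_of_rank_le {p : ℝ} (hp0 : 0 < p) (hp1 : p ≤ 1) {D : EllTwo →L[ℂ] EllTwo}
    {n : ℕ} (hD : (D : EllTwo →ₗ[ℂ] EllTwo).rank ≤ (n : Cardinal)) :
    NucLE p (matrixOf D) (n * ‖D‖ₑ ^ p) := by
  let V := LinearMap.range (D : EllTwo →ₗ[ℂ] EllTwo)
  have hV : Module.rank ℂ V ≤ n := hD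
  have : FiniteDimensional ℂ V :=
    Module.rank_lt_aleph0_iff.1 (hV.trans_lt (Cardinal.natCast_lt_aleph0))
  have hfr : Module.finrank ℂ V ≤ n := by
    rw [← Module.finrank_eq_rank] at hV
    exact_mod_cast hV
  let b := stdOrthonormalBasis ℂ V
  let x : Fin (Module.finrank ℂ V) → EllTwo := fun i => (b i : EllTwo)
  -- The star compensates for the absence of conjugation in the entries `x i j * y i k`.
  let y : Fin (Module.finrank ℂ V) → EllTwo := fun i => star (ContinuousLinearMap.adjoint D (x i))
  have hx : ∀ i, ‖x i‖ₑ = 1 := by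
    intro i
    have : ‖x i‖ = 1 := b.orthonormal.1 i
    rw [← ofReal_norm, this, ENNReal.ofReal_one]
  have hy : ∀ i, ‖y i‖ₑ ≤ ‖D‖ₑ := by
    intro i
    have : ‖y i‖ ≤ ‖D‖ := by
      rw [norm_star]
      refine ((ContinuousLinearMap.adjoint D).le_opNorm _).trans ?_
      have : ‖x i‖ = 1 := b.orthonormal.1 i
      rw [this, mul_one, LinearIsometryEquiv.norm_map]
    rw [← ofReal_norm, ← ofReal_norm]
    exact ENNReal.ofReal_le_ofReal this
  have hexp : ∀ v : EllTwo, D v = ∑ i, inner ℂ (x i) (D v) • x i := by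
    intro v
    have h := b.sum_repr' ⟨D v, LinearMap.mem_range_self _ v⟩
    have h2 := congrArg (fun w : V => (w : EllTwo)) h
    simp only [AddSubmonoidClass.coe_finsetSum, Submodule.coe_smul, Submodule.coe_inner] at h2
    exact h2.symm
  have hent : ∀ j k, matrixOf D j k = ∑ i, x i j * y i k := by
    intro j k
    rw [matrixOf_apply, ← EllTwo.coord_apply, hexp, map_sum]
    refine Finset.sum_congr rfl fun i _ => ?_
    rw [map_smul, EllTwo.coord_apply, ← ContinuousLinearMap.adjoint_inner_left,
      EllTwo.inner_single_eq, smul_eq_mul, mul_comm]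
  have hc : ∑' i, (‖x i‖ₑ * ‖y i‖ₑ) ^ p ≤ n * ‖D‖ₑ ^ p := by
    calc ∑' i, (‖x i‖ₑ * ‖y i‖ₑ) ^ p ≤ ∑' _ : Fin (Module.finrank ℂ V), ‖D‖ₑ ^ p := by
          refine ENNReal.tsum_le_tsum fun i => ?_
          rw [hx, one_mul]
          exact ENNReal.rpow_le_rpow (hy i) hp0.le
      _ = (Module.finrank ℂ V : ℝ≥0∞) * ‖D‖ₑ ^ p := by simp
      _ ≤ _ := by gcongr
  refine (nucLE_tsum hp0 hp1 (fun i => nucLE_rankOne hp0 (x i) (y i)) ?_ fun j k => ?_).mono hc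
  · refine ne_top_of_le_ne_top ?_ hc
    exact ENNReal.mul_ne_top (by simp) (by simp [hp0.le])
  · rw [hent]
    exact hasSum_fintype _

theorem MemSchatten.tendsto_singularNumber {p : ℝ} (hp0 : 0 < p) {T : EllTwo →L[ℂ] EllTwo}
    (hT : MemSchatten p T) :
    Filter.Tendsto (singularNumber T) Filter.atTop (nhds 0) := by
  have h := Summable.tendsto_atTop_zero hT
  have h2 := h.rpow_const (p := p⁻¹) (Or.inr (by positivity))
  rw [Real.zero_rpow (by positivity)] at h2
  refine h2.congr fun n => ?_
  rw [← Real.rpow_mul (singularNumber_nonneg T n), mul_inv_cancel₀ hp0.ne', Real.rpow_one]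

/-- Telescope through near-optimal approximants `R k` of rank at most `2 ^ k`. The differences have
rank `O(2 ^ k)` and norm `O(s_{2^k})` up to the slack `δ k`, so the total cost is a condensed form
of `∑ s_n ^ p`. -/
theorem MemSchatten.exists_nucLE {p : ℝ} (hp0 : 0 < p) (hp1 : p ≤ 1) {T : EllTwo →L[ℂ] EllTwo}
    (hT : MemSchatten p T) : ∃ c : ℝ≥0∞, c ≠ ⊤ ∧ NucLE p (matrixOf T) c := by
  -- This slack, needed because minimizers are not assumed to exist, satisfies `δ k ^ p = 4 ^ (-k)`
  -- and so survives the weight `2 ^ k`.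
  let δ : ℕ → ℝ := fun k => ((1 / 2 : ℝ) ^ k) ^ (2 / p)
  have hδ : ∀ k, 0 < δ k := fun k => by positivity
  let s : ℕ → ℝ := fun k => singularNumber T (2 ^ k)
  have hs0 : ∀ k, 0 ≤ s k := fun k => singularNumber_nonneg _ _
  have hsanti : ∀ k, s (k + 1) ≤ s k := fun k =>
    singularNumber_antitone T (Nat.pow_le_pow_right (by norm_num) (Nat.le_succ k))
  have hδanti : ∀ k, δ (k + 1) ≤ δ k := fun k => by
    refine Real.rpow_le_rpow (by positivity) ?_ (by positivity)
    rw [pow_succ]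
    have : (0 : ℝ) < (1 / 2) ^ k := by positivity
    linarith
  choose R hRrank hRnorm using fun k => exists_norm_sub_lt T (2 ^ k) (hδ k)
  have hRnorm' : ∀ k, ‖T - R k‖ ≤ s k + δ k := fun k => (hRnorm k).le
  have hs : Filter.Tendsto s Filter.atTop (nhds 0) :=
    (hT.tendsto_singularNumber hp0).comp (tendsto_pow_atTop_atTop_of_one_lt (by norm_num))
  have hδp : ∀ k, δ k ^ p = (1 / 4 : ℝ) ^ k := by
    intro k
    rw [← Real.rpow_mul (by positivity), div_mul_cancel₀ _ hp0.ne', Real.rpow_two, ← pow_mul,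
      mul_comm, pow_mul]
    norm_num
  have hδ0 : Filter.Tendsto δ Filter.atTop (nhds 0) := by
    have h1 : Filter.Tendsto (fun k : ℕ => (1 / 2 : ℝ) ^ k) Filter.atTop (nhds 0) :=
      tendsto_pow_atTop_nhds_zero_of_lt_one (by norm_num) (by norm_num)
    have h2 := h1.rpow_const (p := 2 / p) (Or.inr (by positivity))
    rwa [Real.zero_rpow (by positivity)] at h2
  have hR : Filter.Tendsto R Filter.atTop (nhds T) := by
    rw [tendsto_iff_norm_sub_tendsto_zero]
    refine squeeze_zero (fun k => norm_nonneg _) (fun k => ?_) (by simpa using hs.add hδ0)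
    rw [norm_sub_rev]
    exact hRnorm' k
  let D : ℕ → EllTwo →L[ℂ] EllTwo := fun k => R (k + 1) - R k
  have hDrank : ∀ k, (D k : EllTwo →ₗ[ℂ] EllTwo).rank ≤ ((2 ^ (k + 2) : ℕ) : Cardinal) := by
    intro k
    have h := rank_add_le_natCast (hRrank (k + 1)) (rank_neg_le_natCast (hRrank k))
    rw [← sub_eq_add_neg] at h
    refine h.trans ?_
    have : 2 ^ (k + 1) + 2 ^ k ≤ 2 ^ (k + 2) := by
      have := Nat.pow_le_pow_right (n := 2) (by norm_num) (Nat.le_succ k)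
      rw [pow_succ 2 (k + 1)]
      omega
    exact_mod_cast this
  have hDnorm : ∀ k, ‖D k‖ ≤ 2 * (s k + δ k) := by
    intro k
    have : D k = (T - R k) - (T - R (k + 1)) := by simp [D]
    rw [this]
    refine (norm_sub_le _ _).trans ?_
    linarith [hRnorm' k, hRnorm' (k + 1), hsanti k, hδanti k]
  let c : ℕ → ℝ := fun k => 2 ^ (k + 2) * ‖D k‖ ^ p
  have hsumm : Summable c := by
    have h1 : Summable fun k : ℕ => (2 : ℝ) ^ k * s k ^ p := by
      refine (summable_condensed_iff_of_nonneg (f := fun n => singularNumber T n ^ p) ?_ ?_).2 hT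
      · exact fun n => Real.rpow_nonneg (singularNumber_nonneg _ _) _
      · intro m n _ hmn
        exact Real.rpow_le_rpow (singularNumber_nonneg _ _) (singularNumber_antitone T hmn) hp0.le
    have h2 : Summable fun k : ℕ => (1 / 2 : ℝ) ^ k :=
      summable_geometric_of_lt_one (by norm_num) (by norm_num)
    refine Summable.of_nonneg_of_le (fun k => by positivity) (fun k => ?_)
      ((h1.add h2).mul_left (4 * 2 ^ p))
    have h3 : ‖D k‖ ^ p ≤ 2 ^ p * (s k ^ p + δ k ^ p) := by
      refine (Real.rpow_le_rpow (norm_nonneg _) (hDnorm k) hp0.le).trans ?_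
      rw [Real.mul_rpow (by norm_num) (add_nonneg (hs0 k) (hδ k).le)]
      gcongr
      exact Real.rpow_add_le_add_rpow (hs0 k) (hδ k).le hp0.le hp1
    calc c k ≤ 2 ^ (k + 2) * (2 ^ p * (s k ^ p + δ k ^ p)) := by
          simp only [c]; gcongr
      _ = 4 * 2 ^ p * (2 ^ k * s k ^ p + 2 ^ k * δ k ^ p) := by ring
      _ = _ := by
        rw [hδp k, ← mul_pow]
        norm_num
  let cost : ℕ → ℝ≥0∞ := fun o => Nat.casesOn o ((2 ^ 0 : ℕ) * ‖R 0‖ₑ ^ p)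
    fun k => (2 ^ (k + 2) : ℕ) * ‖D k‖ₑ ^ p
  let A : ℕ → EllTwo →L[ℂ] EllTwo := fun o => Nat.casesOn o (R 0) D
  have hck : ∀ k, ((2 ^ (k + 2) : ℕ) : ℝ≥0∞) * ‖D k‖ₑ ^ p = ENNReal.ofReal (c k) := by
    intro k
    rw [ENNReal.ofReal_mul (by positivity), ← ENNReal.ofReal_rpow_of_nonneg (norm_nonneg _) hp0.le,
      ofReal_norm, ENNReal.ofReal_pow (by norm_num)]
    norm_num
  have hcost : ∑' o, cost o ≠ ⊤ := by
    rw [tsum_eq_zero_add' ENNReal.summable]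
    refine ENNReal.add_ne_top.2 ⟨ENNReal.mul_ne_top (by simp) (by simp [hp0.le]), ?_⟩
    have : ∑' k, cost (k + 1) = ∑' k, ENNReal.ofReal (c k) := tsum_congr hck
    rw [this]
    exact hsumm.tsum_ofReal_ne_top
  have hAsum : ∀ n, ∑ i ∈ Finset.range (n + 1), A i = R n := by
    intro n
    induction n with
    | zero => simp [A]
    | succ n ih =>
      rw [Finset.sum_range_succ, ih]
      simp [A, D]
  have hAnuc : ∀ i, NucLE p (matrixOf (A i)) (cost i) := by
    rintro (_ | k)
    · exact nucLE_matrixOf_of_rank_le hp0 hp1 (hRrank 0)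
    · exact nucLE_matrixOf_of_rank_le hp0 hp1 (hDrank k)
  have hDsum : Summable fun k => ‖D k‖ := by
    have h1 : ∑' k, ‖D k‖ₑ ^ p ≠ ⊤ := by
      refine ne_top_of_le_ne_top hsumm.tsum_ofReal_ne_top (ENNReal.tsum_le_tsum fun k => ?_)
      rw [← hck]
      refine le_mul_of_one_le_left (zero_le) ?_
      exact_mod_cast Nat.one_le_two_pow
    have h2 := ENNReal.tsum_ne_top_of_tsum_rpow_ne_top hp0 hp1 h1
    simpa using ENNReal.summable_toReal h2
  have hAsummable : Summable A := by
    rw [← summable_nat_add_iff 1]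
    exact hDsum.of_norm
  have hA : HasSum A T := by
    rw [hAsummable.hasSum_iff_tendsto_nat, ← Filter.tendsto_add_atTop_iff_nat 1]
    simpa only [hAsum] using hR
  refine ⟨∑' o, cost o, hcost, nucLE_tsum hp0 hp1 hAnuc hcost fun j k => ?_⟩
  have := (matrixEntry j k).hasSum hA
  simpa only [matrixEntry_apply] using this

/-! ### Absolutely convergent sums of rank one operators -/

/-- Greedy deflation: after `m ≤ n` pairs, compressing `R` away from the spans of `e` and `g` is a
perturbation of rank at most `2 * n`, so the remainder still has norm above `t` and yields another
pair. -/
theorem exists_orthonormal_le_norm_inner {R : EllTwo →L[ℂ] EllTwo} {t : ℝ} {n : ℕ} (ht0 : 0 ≤ t)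
    (ht : t < singularNumber R (2 * n)) (m : ℕ) (hm : m ≤ n + 1) :
    ∃ e g : Fin m → EllTwo, Orthonormal ℂ e ∧ Orthonormal ℂ g ∧
      ∀ i, t ≤ ‖inner ℂ (g i) (R (e i))‖ := by
  induction m with
  | zero => exact ⟨Fin.elim0, Fin.elim0, ⟨fun i => i.elim0, fun i => i.elim0⟩,
      ⟨fun i => i.elim0, fun i => i.elim0⟩, fun i => i.elim0⟩
  | succ m ih =>
    obtain ⟨e, g, he, hg, heg⟩ := ih (by omega)
    let V := Submodule.span ℂ (Set.range e)
    let W := Submodule.span ℂ (Set.range g)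
    have : FiniteDimensional ℂ V := FiniteDimensional.span_of_finite ℂ (Set.finite_range e)
    have : FiniteDimensional ℂ W := FiniteDimensional.span_of_finite ℂ (Set.finite_range g)
    have hrank : ∀ f : Fin m → EllTwo, Module.rank ℂ (Submodule.span ℂ (Set.range f)) ≤
        (m : Cardinal) := by
      intro f
      refine (rank_span_le _).trans ?_
      refine Cardinal.mk_range_le.trans ?_
      simp
    let P := V.starProjection
    let Q := W.starProjection
    have hP : (P : EllTwo →ₗ[ℂ] EllTwo).rank ≤ (m : Cardinal) := by
      rw [LinearMap.rank, Submodule.range_starProjection]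
      exact hrank e
    have hQ : (Q : EllTwo →ₗ[ℂ] EllTwo).rank ≤ (m : Cardinal) := by
      rw [LinearMap.rank, Submodule.range_starProjection]
      exact hrank g
    -- Chosen so that `R - B = (1 - Q) R (1 - P)`.
    let B : EllTwo →L[ℂ] EllTwo := Q.comp R + (R - Q.comp R).comp P
    have hB : (B : EllTwo →ₗ[ℂ] EllTwo).rank ≤ ((2 * n : ℕ) : Cardinal) := by
      have h1 := rank_add_le_natCast (A := Q.comp R) (B := (R - Q.comp R).comp P) (m := m) (n := m)
        ((LinearMap.rank_comp_le_left _ _).trans hQ) ((LinearMap.rank_comp_le_right _ _).trans hP)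
      refine h1.trans ?_
      have : m + m ≤ 2 * n := by omega
      exact_mod_cast this
    have hlt : t < ‖R - B‖ := ht.trans_le (singularNumber_le hB)
    obtain ⟨v, hv⟩ : ∃ v, t * ‖v‖ < ‖(R - B) v‖ := by
      by_contra! h
      exact absurd (ContinuousLinearMap.opNorm_le_bound _ ht0 h) (not_le.2 hlt)
    let w := v - P v
    let u := R w - Q (R w)
    have hRB : (R - B) v = u := by
      simp only [u, w, B, sub_apply, add_apply,
        ContinuousLinearMap.comp_apply, map_sub]
      abel
    have hwV : w ∈ Vᗮ := Submodule.sub_starProjection_mem_orthogonal v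
    have huW : u ∈ Wᗮ := Submodule.sub_starProjection_mem_orthogonal (R w)
    have hwv : ‖w‖ ≤ ‖v‖ := by
      have h := Submodule.norm_starProjection_apply_le (K := Vᗮ) v
      rwa [Submodule.starProjection_orthogonal_val] at h
    rw [hRB] at hv
    have hupos : 0 < ‖u‖ := lt_of_le_of_lt (by positivity) hv
    have hwpos : 0 < ‖w‖ := by
      rw [norm_pos_iff]
      intro h
      simp [u, h] at hupos
    have hunit : ∀ z : EllTwo, 0 < ‖z‖ → ‖((‖z‖ : ℂ)⁻¹ • z)‖ = 1 := by
      intro z hz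
      rw [norm_smul, norm_inv, Complex.norm_real, norm_norm, inv_mul_cancel₀ hz.ne']
    refine ⟨Matrix.vecCons ((‖w‖ : ℂ)⁻¹ • w) e, Matrix.vecCons ((‖u‖ : ℂ)⁻¹ • u) g,
      orthonormal_vecCons_iff.2 ⟨hunit w hwpos, fun i => ?_, he⟩,
      orthonormal_vecCons_iff.2 ⟨hunit u hupos, fun i => ?_, hg⟩, ?_⟩
    · rw [inner_smul_left, (Submodule.mem_orthogonal' _ _).1 hwV _
        (Submodule.subset_span ⟨i, rfl⟩), mul_zero]
    · rw [inner_smul_left, (Submodule.mem_orthogonal' _ _).1 huW _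
        (Submodule.subset_span ⟨i, rfl⟩), mul_zero]
    · intro i
      refine Fin.cases ?_ (fun i => ?_) i
      · simp only [Matrix.cons_val_zero, map_smul, inner_smul_left, inner_smul_right]
        -- As `u` is orthogonal to `Q (R w)`, the normalized pair gives `‖u‖ / ‖w‖`, which is at
        -- least `t` since `‖w‖ ≤ ‖v‖`.
        have h1 : inner ℂ u (R w) = ((‖u‖ : ℂ)) ^ 2 := by
          have h2 : R w = u + Q (R w) := by simp [u]
          rw [h2, inner_add_right, inner_self_eq_norm_sq_to_K,
            (Submodule.mem_orthogonal' _ _).1 huW _ (Submodule.starProjection_apply_mem _ _)]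
          simp
        rw [h1, norm_mul, norm_mul, norm_pow, RCLike.norm_conj, norm_inv, norm_inv,
          Complex.norm_real, Complex.norm_real, norm_norm, norm_norm]
        have h3 : ‖w‖⁻¹ * (‖u‖⁻¹ * ‖u‖ ^ 2) = ‖u‖ / ‖w‖ := by field_simp
        rw [h3, le_div_iff₀ hwpos]
        exact (mul_le_mul_of_nonneg_left hwv ht0).trans hv.le
      · simpa using heg i

open InnerProductSpace in
/-- The operator with matrix entries `∑ i ∈ s, x i j * y i k`. -/
noncomputable def sumRankOne {ι : Type*} (x y : ι → EllTwo) (s : Finset ι) : EllTwo →L[ℂ] EllTwo :=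
  ∑ i ∈ s, rankOne ℂ (x i) (star (y i))

open InnerProductSpace in
-- Test the operator on `n + 1` orthonormal pairs. By Cauchy–Schwarz and Bessel's inequality each
-- rank one term contributes at most `‖x i‖ * ‖y i‖` to the sum of all pairings.
theorem add_one_mul_singularNumber_sumRankOne_le {ι : Type*} (x y : ι → EllTwo) (s : Finset ι)
    (n : ℕ) :
    (n + 1) * singularNumber (sumRankOne x y s) (2 * n) ≤ ∑ i ∈ s, ‖x i‖ * ‖y i‖ := by
  set R := sumRankOne x y s
  have key : ∀ t : ℝ, 0 ≤ t → t < singularNumber R (2 * n) →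
      (n + 1) * t ≤ ∑ i ∈ s, ‖x i‖ * ‖y i‖ := by
    intro t ht0 ht
    obtain ⟨e, g, he, hg, heg⟩ := exists_orthonormal_le_norm_inner ht0 ht (n + 1) le_rfl
    calc (n + 1) * t = ∑ _l : Fin (n + 1), t := by simp
      _ ≤ ∑ l, ‖inner ℂ (g l) (R (e l))‖ := Finset.sum_le_sum fun l _ => heg l
      _ ≤ ∑ l, ∑ i ∈ s, ‖inner ℂ (g l) (x i)‖ * ‖inner ℂ (e l) (star (y i))‖ := by
          refine Finset.sum_le_sum fun l _ => ?_
          simp only [R, sumRankOne, sum_apply, rankOne_apply, inner_sum,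
            inner_smul_right]
          refine (norm_sum_le _ _).trans (Finset.sum_le_sum fun i _ => ?_)
          rw [norm_mul, mul_comm, norm_inner_symm (star (y i))]
      _ = ∑ i ∈ s, ∑ l, ‖inner ℂ (g l) (x i)‖ * ‖inner ℂ (e l) (star (y i))‖ := Finset.sum_comm
      _ ≤ ∑ i ∈ s, ‖x i‖ * ‖y i‖ := by
          refine Finset.sum_le_sum fun i _ => ?_
          have h1 := hg.sum_inner_products_le (x i) (s := Finset.univ)
          have h2 := he.sum_inner_products_le (star (y i)) (s := Finset.univ)
          rw [norm_star] at h2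
          refine abs_le_of_sq_le_sq' ?_ (by positivity) |>.2
          refine (Finset.sum_mul_sq_le_sq_mul_sq _ _ _).trans ?_
          rw [mul_pow]
          gcongr
  rcases (singularNumber_nonneg R (2 * n)).eq_or_lt with h | h
  · rw [← h, mul_zero]
    positivity
  · by_contra! hcon
    rw [← div_lt_iff₀' (by positivity)] at hcon
    obtain ⟨t, ht1, ht2⟩ := exists_between hcon
    have h3 := key t (le_trans (by positivity) ht1.le) ht2
    rw [div_lt_iff₀' (by positivity)] at ht1
    linarith

open InnerProductSpace in
theorem rank_sumRankOne_le {ι : Type*} (x y : ι → EllTwo) (s : Finset ι) :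
    (sumRankOne x y s : EllTwo →ₗ[ℂ] EllTwo).rank ≤ (s.card : Cardinal) := by
  classical
  induction s using Finset.induction_on with
  | empty => simp [sumRankOne]
  | insert a s ha ih =>
    rw [sumRankOne, Finset.sum_insert ha, Finset.card_insert_of_notMem ha, add_comm]
    refine rank_add_le_natCast ih (n := 1) ?_
    rw [toLinearMap_rankOne]
    rw [Nat.cast_one, LinearMap.rank]
    refine (Submodule.rank_mono (t := Submodule.span ℂ {x a}) ?_).trans
      ((rank_span_le _).trans (by simp))
    rintro _ ⟨v, rfl⟩
    exact Submodule.smul_mem _ _ (Submodule.mem_span_singleton_self _)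

/-- The terms in `F` form an operator of rank at most `n`; discarding them costs a shift of `n` in
the index, whence `3 * n`. -/
theorem add_one_mul_singularNumber_sumRankOne_le_sdiff {ι : Type*} [DecidableEq ι]
    (x y : ι → EllTwo) (s F : Finset ι) (hF : F ⊆ s) {n : ℕ} (hn : F.card ≤ n) :
    (n + 1) * singularNumber (sumRankOne x y s) (3 * n) ≤ ∑ i ∈ s \ F, ‖x i‖ * ‖y i‖ := by
  refine le_trans ?_ (add_one_mul_singularNumber_sumRankOne_le x y (s \ F) n)
  gcongr
  have h : sumRankOne x y s - sumRankOne x y F = sumRankOne x y (s \ F) := by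
    rw [sumRankOne, sumRankOne, sumRankOne, ← Finset.sum_sdiff hF, add_sub_cancel_right]
  rw [← h, show 3 * n = 2 * n + n by ring]
  refine singularNumber_add_index_le _ ((rank_sumRankOne_le x y F).trans ?_)
  exact_mod_cast hn

theorem two_pow_mul_singularNumber_sumRankOne_le (x y : ℕ → EllTwo) (N k : ℕ) :
    2 ^ k * ENNReal.ofReal (singularNumber (sumRankOne x y (Finset.range N)) (2 ^ (k + 2))) ≤
      ∑' i, ‖x (i + 2 ^ k)‖ₑ * ‖y (i + 2 ^ k)‖ₑ := by
  have h := add_one_mul_singularNumber_sumRankOne_le_sdiff x y (Finset.range N)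
    (Finset.range N ∩ Finset.range (2 ^ k)) Finset.inter_subset_left (n := 2 ^ k)
    ((Finset.card_le_card Finset.inter_subset_right).trans (by simp))
  have h1 : (2 : ℝ) ^ k * singularNumber (sumRankOne x y (Finset.range N)) (2 ^ (k + 2)) ≤
      ∑ i ∈ Finset.range N \ (Finset.range N ∩ Finset.range (2 ^ k)), ‖x i‖ * ‖y i‖ := by
    refine le_trans ?_ h
    push_cast
    gcongr
    · exact singularNumber_nonneg _ _
    · linarith
    · refine singularNumber_antitone _ ?_
      rw [pow_add]; omega
  have h2 := ENNReal.ofReal_le_ofReal h1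
  rw [ENNReal.ofReal_mul (by positivity), ENNReal.ofReal_sum_of_nonneg (fun _ _ => by positivity),
    ENNReal.ofReal_pow (by norm_num), ENNReal.ofReal_ofNat] at h2
  refine h2.trans ?_
  calc ∑ i ∈ Finset.range N \ (Finset.range N ∩ Finset.range (2 ^ k)),
        ENNReal.ofReal (‖x i‖ * ‖y i‖)
      ≤ ∑ i ∈ Finset.image (fun i => i + 2 ^ k) (Finset.range N),
          ENNReal.ofReal (‖x i‖ * ‖y i‖) := by
        refine Finset.sum_le_sum_of_subset fun i hi => ?_
        simp only [Finset.mem_sdiff, Finset.mem_range, Finset.mem_inter, not_and, not_lt] at hi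
        exact Finset.mem_image.2 ⟨i - 2 ^ k, Finset.mem_range.2 ((Nat.sub_le _ _).trans_lt hi.1),
          Nat.sub_add_cancel (hi.2 hi.1)⟩
    _ = ∑ i ∈ Finset.range N, ‖x (i + 2 ^ k)‖ₑ * ‖y (i + 2 ^ k)‖ₑ := by
        rw [Finset.sum_image fun a _ b _ hab => by simpa using hab]
        refine Finset.sum_congr rfl fun i _ => ?_
        rw [ENNReal.ofReal_mul (norm_nonneg _), ofReal_norm, ofReal_norm]
    _ ≤ _ := ENNReal.sum_le_tsum _

/-! ### Dyadic condensation and the Hardy inequality -/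

theorem tsum_tail_le_condensed {f : ℕ → ℝ≥0∞} (hf : Antitone f) (k : ℕ) :
    ∑' i, f (i + 2 ^ k) ≤ ∑' j : ℕ, 2 ^ (k + j) * f (2 ^ (k + j)) := by
  have hmono : Monotone fun j : ℕ => 2 ^ (k + j) := fun a b hab =>
    Nat.pow_le_pow_right (by norm_num) (Nat.add_le_add_left hab k)
  have htend : Filter.Tendsto (fun n : ℕ => 2 ^ (k + n) - 2 ^ k) Filter.atTop Filter.atTop := by
    refine (Filter.tendsto_sub_atTop_nat _).comp ?_
    refine (tendsto_pow_atTop_atTop_of_one_lt one_lt_two).comp ?_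
    exact Filter.tendsto_atTop_mono (fun n => Nat.le_add_left n k) Filter.tendsto_id
  rw [ENNReal.tsum_eq_iSup_nat' htend]
  refine iSup_le fun n => ?_
  have h := Finset.le_sum_schlomilch' (f := f) (u := fun j => 2 ^ (k + j))
    (fun a b _ hab => hf hab) (fun j => Nat.two_pow_pos (k + j)) hmono n
  rw [Finset.sum_Ico_eq_sum_range, add_zero] at h
  simp_rw [add_comm _ (2 ^ k)]
  refine (h.trans (Finset.sum_le_sum fun j _ => ?_)).trans
    (ENNReal.sum_le_tsum (Finset.range n))
  rw [nsmul_eq_mul, ← add_assoc, pow_succ, mul_two, Nat.add_sub_cancel]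
  simp

/-- A discrete Hardy inequality for decreasing sequences and exponents less than `1`. -/
theorem tsum_two_pow_mul_tail_rpow_le {p : ℝ} (hp0 : 0 < p) (hp1 : p < 1) {f : ℕ → ℝ≥0∞}
    (hf : Antitone f) :
    ∑' k : ℕ, ((2 : ℝ≥0∞) ^ k) ^ (1 - p) * (∑' i, f (i + 2 ^ k)) ^ p ≤
      (∑' j : ℕ, (((2 : ℝ≥0∞) ^ (1 - p))⁻¹) ^ j) * (3 * ∑' i, f i ^ p) := by
  have h2 : ∀ k : ℕ, (2 : ℝ≥0∞) ^ k ≠ 0 := fun k => by simp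
  have h2' : ∀ k : ℕ, (2 : ℝ≥0∞) ^ k ≠ ⊤ := fun k => by simp
  have htail : ∀ k : ℕ, ∑' i, f (i + 2 ^ k) ≤ ∑' j : ℕ, 2 ^ (k + j) * f (2 ^ (k + j)) :=
    tsum_tail_le_condensed hf
  calc ∑' k : ℕ, ((2 : ℝ≥0∞) ^ k) ^ (1 - p) * (∑' i, f (i + 2 ^ k)) ^ p
      ≤ ∑' k : ℕ, ∑' j : ℕ, (((2 : ℝ≥0∞) ^ (1 - p))⁻¹) ^ j *
          (2 ^ (k + j) * f (2 ^ (k + j)) ^ p) := by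
        refine ENNReal.tsum_le_tsum fun k => ?_
        calc _ ≤ ((2 : ℝ≥0∞) ^ k) ^ (1 - p) *
              ∑' j : ℕ, (2 ^ (k + j) * f (2 ^ (k + j))) ^ p := by
              gcongr
              exact (ENNReal.rpow_le_rpow (htail k) hp0.le).trans
                (ENNReal.rpow_tsum_le_tsum_rpow hp0 hp1.le _)
          _ = ∑' j : ℕ, ((2 : ℝ≥0∞) ^ k) ^ (1 - p) * (2 ^ (k + j) * f (2 ^ (k + j))) ^ p :=
              ENNReal.tsum_mul_left.symm
          _ = _ := by
              -- The powers of two match: `k (1 - p) + (k + j) p = (k + j) - j (1 - p)`. The factor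
              -- `2 ^ (-j (1 - p))` is summable because `p < 1`.
              refine tsum_congr fun j => ?_
              rw [ENNReal.mul_rpow_of_nonneg _ _ hp0.le, ← mul_assoc, ← mul_assoc]
              congr 1
              rw [← ENNReal.inv_pow, ← ENNReal.rpow_natCast, ← ENNReal.rpow_natCast,
                ← ENNReal.rpow_natCast, ← ENNReal.rpow_mul, ← ENNReal.rpow_mul, ← ENNReal.rpow_mul,
                ← ENNReal.rpow_neg, ← ENNReal.rpow_add _ _ (by simp) (by simp),
                ← ENNReal.rpow_add _ _ (by simp) (by simp)]
              congr 1
              push_cast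
              ring
    _ = ∑' j : ℕ, (((2 : ℝ≥0∞) ^ (1 - p))⁻¹) ^ j * ∑' k : ℕ,
          (2 ^ (k + j) * f (2 ^ (k + j)) ^ p) := by
        rw [ENNReal.tsum_comm]
        simp_rw [ENNReal.tsum_mul_left]
    _ ≤ ∑' j : ℕ, (((2 : ℝ≥0∞) ^ (1 - p))⁻¹) ^ j * (3 * ∑' i, f i ^ p) := by
        refine ENNReal.tsum_le_tsum fun j => ?_
        gcongr
        calc ∑' k : ℕ, (2 ^ (k + j) * f (2 ^ (k + j)) ^ p)
            ≤ ∑' l : ℕ, (2 ^ l * f (2 ^ l) ^ p) :=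
              ENNReal.tsum_comp_le_tsum_of_injective (add_left_injective j)
                (fun l => (2 : ℝ≥0∞) ^ l * f (2 ^ l) ^ p)
          _ ≤ f 1 ^ p + 2 * ∑' i, f i ^ p :=
              ENNReal.tsum_condensed_le (f := fun i => f i ^ p)
                fun m n _ hmn => ENNReal.rpow_le_rpow (hf hmn) hp0.le
          _ ≤ ∑' i, f i ^ p + 2 * ∑' i, f i ^ p := by
              gcongr
              exact ENNReal.le_tsum 1
          _ = _ := by ring
    _ = _ := ENNReal.tsum_mul_right

theorem tsum_singularNumber_rpow_le {p : ℝ} (hp0 : 0 < p) (T : EllTwo →L[ℂ] EllTwo) :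
    ∑' n, ENNReal.ofReal (singularNumber T n ^ p) ≤
      4 * ENNReal.ofReal (singularNumber T 0 ^ p) +
        4 * ∑' k : ℕ, 2 ^ k * ENNReal.ofReal (singularNumber T (2 ^ (k + 2))) ^ p := by
  have hanti : ∀ ⦃m n⦄, m ≤ n → ENNReal.ofReal (singularNumber T n ^ p) ≤
      ENNReal.ofReal (singularNumber T m ^ p) := fun m n hmn =>
    ENNReal.ofReal_le_ofReal
      (Real.rpow_le_rpow (singularNumber_nonneg _ _) (singularNumber_antitone T hmn) hp0.le)
  refine (ENNReal.le_tsum_schlomilch (u := fun k => 2 ^ (k + 2)) (fun m n _ hmn => hanti hmn)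
    (fun _ => by positivity) (fun a b hab => Nat.pow_lt_pow_right (by norm_num)
      (by omega))).trans ?_
  gcongr
  · calc _ ≤ ∑ _i ∈ Finset.range (2 ^ (0 + 2)), ENNReal.ofReal (singularNumber T 0 ^ p) :=
          Finset.sum_le_sum fun i _ => hanti (Nat.zero_le i)
      _ = _ := by simp
  · rw [← ENNReal.tsum_mul_left]
    refine ENNReal.tsum_le_tsum fun k => ?_
    rw [ENNReal.ofReal_rpow_of_nonneg (singularNumber_nonneg _ _) hp0.le, ← mul_assoc]
    gcongr
    rw [tsub_le_iff_right]
    push_cast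
    rw [pow_succ, pow_succ, pow_succ]
    refine le_of_eq ?_
    ring

/-- The tail estimates drop the first `2 ^ k` terms, and the Hardy inequality needs a decreasing
sequence. Sorting finitely many terms changes neither the operator nor, apart from the omitted
terms, the cost. -/
theorem exists_antitone_sumRankOne_eq (x y : ℕ → EllTwo) (N : ℕ) :
    ∃ x' y' : ℕ → EllTwo, Antitone (fun i => ‖x' i‖ₑ * ‖y' i‖ₑ) ∧
      sumRankOne x' y' (Finset.range N) = sumRankOne x y (Finset.range N) ∧
      ∀ p : ℝ, 0 < p → ∑' i, (‖x' i‖ₑ * ‖y' i‖ₑ) ^ p ≤ ∑' i, (‖x i‖ₑ * ‖y i‖ₑ) ^ p := by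
  classical
  let l : Fin N → ℝ≥0∞ᵒᵈ := fun i => OrderDual.toDual (‖x i‖ₑ * ‖y i‖ₑ)
  let σ := Tuple.sort l
  have hσ : ∀ i j : Fin N, i ≤ j → ‖x (σ j)‖ₑ * ‖y (σ j)‖ₑ ≤ ‖x (σ i)‖ₑ * ‖y (σ i)‖ₑ :=
    fun i j hij => Tuple.monotone_sort l hij
  let x' : ℕ → EllTwo := fun i => if h : i < N then x (σ ⟨i, h⟩) else 0
  let y' : ℕ → EllTwo := fun i => if h : i < N then y (σ ⟨i, h⟩) else 0
  have hx' : ∀ i : Fin N, x' i = x (σ i) := fun i => by simp [x']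
  have hy' : ∀ i : Fin N, y' i = y (σ i) := fun i => by simp [y']
  refine ⟨x', y', fun i j hij => ?_, ?_, fun p hp => ?_⟩
  · by_cases hj : j < N
    · simpa [x', y', hj, hij.trans_lt hj] using hσ ⟨i, hij.trans_lt hj⟩ ⟨j, hj⟩ hij
    · simp [x', hj]
  · rw [sumRankOne, sumRankOne, Finset.sum_range, Finset.sum_range]
    simp only [hx', hy']
    exact Equiv.sum_comp σ fun i : Fin N =>
      InnerProductSpace.rankOne ℂ (x i) (star (y i))
  · calc ∑' i, (‖x' i‖ₑ * ‖y' i‖ₑ) ^ p = ∑ i ∈ Finset.range N, (‖x' i‖ₑ * ‖y' i‖ₑ) ^ p := by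
          refine tsum_eq_sum fun i hi => ?_
          simp only [Finset.mem_range] at hi
          simp [x', hi, hp]
      _ = ∑ i : Fin N, (‖x (σ i)‖ₑ * ‖y (σ i)‖ₑ) ^ p := by
          rw [Finset.sum_range]
          simp only [hx', hy']
      _ = ∑ i : Fin N, (‖x i‖ₑ * ‖y i‖ₑ) ^ p :=
          Equiv.sum_comp σ fun i : Fin N => (‖x i‖ₑ * ‖y i‖ₑ) ^ p
      _ = ∑ i ∈ Finset.range N, (‖x i‖ₑ * ‖y i‖ₑ) ^ p :=
          (Finset.sum_range fun i => (‖x i‖ₑ * ‖y i‖ₑ) ^ p).symm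
      _ ≤ _ := ENNReal.sum_le_tsum _

theorem tsum_inv_two_rpow_pow_ne_top {p : ℝ} (hp1 : p < 1) :
    ∑' j : ℕ, (((2 : ℝ≥0∞) ^ (1 - p))⁻¹) ^ j ≠ ⊤ := by
  rw [ENNReal.tsum_geometric]
  refine ENNReal.inv_ne_top.2 (tsub_pos_of_lt ?_).ne'
  rw [ENNReal.inv_lt_one]
  exact ENNReal.one_lt_rpow (by norm_num) (by linarith)

theorem tsum_two_pow_mul_singularNumber_sumRankOne_rpow_le {p : ℝ} (hp0 : 0 < p) (hp1 : p < 1)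
    (x y : ℕ → EllTwo) (N : ℕ) :
    ∑' k : ℕ, 2 ^ k * ENNReal.ofReal
        (singularNumber (sumRankOne x y (Finset.range N)) (2 ^ (k + 2))) ^ p ≤
      (∑' j : ℕ, (((2 : ℝ≥0∞) ^ (1 - p))⁻¹) ^ j) * (3 * ∑' i, (‖x i‖ₑ * ‖y i‖ₑ) ^ p) := by
  obtain ⟨x', y', hanti, hT, hle⟩ := exists_antitone_sumRankOne_eq x y N
  calc _ ≤ ∑' k : ℕ, ((2 : ℝ≥0∞) ^ k) ^ (1 - p) *
        (∑' i, ‖x' (i + 2 ^ k)‖ₑ * ‖y' (i + 2 ^ k)‖ₑ) ^ p := by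
        refine ENNReal.tsum_le_tsum fun k => ?_
        rw [← hT]
        refine le_trans (le_of_eq ?_) (mul_le_mul_right (ENNReal.rpow_le_rpow
          (two_pow_mul_singularNumber_sumRankOne_le x' y' N k) hp0.le) _)
        rw [ENNReal.mul_rpow_of_nonneg _ _ hp0.le, ← mul_assoc,
          ← ENNReal.rpow_add _ _ (by simp) (by simp), sub_add_cancel, ENNReal.rpow_one]
    _ ≤ _ := tsum_two_pow_mul_tail_rpow_le hp0 hp1 hanti
    _ ≤ _ := mul_le_mul_right (mul_le_mul_right (hle p hp0) 3) _

open InnerProductSpace in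
/-- A `p`-summable sum of rank one matrices is the matrix of an operator of class `S_p`. -/
theorem NucLE.exists_memSchatten {p : ℝ} (hp0 : 0 < p) (hp1 : p < 1) {a : ℕ → ℕ → ℂ} {c : ℝ≥0∞}
    (hc : c ≠ ⊤) (h : NucLE p a c) :
    ∃ C : EllTwo →L[ℂ] EllTwo, MemSchatten p C ∧ matrixOf C = Matrix.of a := by
  obtain ⟨x, y, hxy, hcost⟩ := h
  have hs : Summable fun i => rankOne ℂ (x i) (star (y i)) := by
    apply summable_of_tsum_enorm_ne_top
    have := ENNReal.tsum_ne_top_of_tsum_rpow_ne_top hp0 hp1.le (ne_top_of_le_ne_top hc hcost)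
    convert! this using 4 with i
    rw [enorm_rankOne]
    congr 1
    rw [← ofReal_norm, norm_star, ofReal_norm]
  let C := ∑' i, rankOne ℂ (x i) (star (y i))
  have hC : HasSum (fun i => rankOne ℂ (x i) (star (y i))) C := hs.hasSum
  have hCt : Filter.Tendsto (fun N => sumRankOne x y (Finset.range N)) Filter.atTop (nhds C) :=
    hC.tendsto_sum_nat
  refine ⟨C, ?_, ?_⟩
  · let K := (∑' j : ℕ, (((2 : ℝ≥0∞) ^ (1 - p))⁻¹) ^ j) * (3 * ∑' i, (‖x i‖ₑ * ‖y i‖ₑ) ^ p)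
    have hK : K ≠ ⊤ := ENNReal.mul_ne_top (tsum_inv_two_rpow_pow_ne_top hp1)
      (ENNReal.mul_ne_top (by norm_num) (ne_top_of_le_ne_top hc hcost))
    have hle : ∑' k : ℕ, 2 ^ k * ENNReal.ofReal (singularNumber C (2 ^ (k + 2))) ^ p ≤ K := by
      -- Finite partial sums depend continuously on the operator, so the bound that is uniform in
      -- `N` passes to the norm limit `C`.
      rw [ENNReal.tsum_eq_iSup_nat]
      refine iSup_le fun m => ?_
      have hcont : Continuous fun T : EllTwo →L[ℂ] EllTwo => ∑ k ∈ Finset.range m,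
          2 ^ k * ENNReal.ofReal (singularNumber T (2 ^ (k + 2))) ^ p := by
        refine continuous_finsetSum _ fun k _ => ?_
        refine (ENNReal.continuous_const_mul (by simp)).comp ?_
        exact ENNReal.continuous_rpow_const.comp
          (ENNReal.continuous_ofReal.comp (continuous_singularNumber _))
      refine le_of_tendsto' ((hcont.tendsto C).comp hCt) fun N => ?_
      exact (ENNReal.sum_le_tsum _).trans
        (tsum_two_pow_mul_singularNumber_sumRankOne_rpow_le hp0 hp1 x y N)
    have hfin : ∑' n, ENNReal.ofReal (singularNumber C n ^ p) ≠ ⊤ := by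
      refine ne_top_of_le_ne_top ?_ (tsum_singularNumber_rpow_le hp0 C)
      refine ENNReal.add_ne_top.2 ⟨ENNReal.mul_ne_top (by norm_num) ENNReal.ofReal_ne_top,
        ENNReal.mul_ne_top (by norm_num) (ne_top_of_le_ne_top hK hle)⟩
    have := ENNReal.summable_toReal hfin
    refine this.congr fun n => ?_
    rw [ENNReal.toReal_ofReal (Real.rpow_nonneg (singularNumber_nonneg _ _) _)]
  · ext j k
    have h1 := (matrixEntry j k).hasSum hC
    have h2 : ∀ i, matrixEntry j k (rankOne ℂ (x i) (star (y i))) = x i j * y i k := by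
      intro i
      rw [matrixEntry_apply, matrixOf_apply, rankOne_apply, EllTwo.inner_single_eq, star_star,
        ← EllTwo.coord_apply, map_smul, EllTwo.coord_apply, smul_eq_mul, mul_comm]
    simp only [h2, matrixEntry_apply] at h1
    exact h1.unique (hxy j k)

/-! ### Schur multipliers and rank one operators -/

/-- The Schur multiplication by `A` takes `x ⊗ y` to a sum of rank one matrices of cost at most
`M (‖x‖ ‖y‖) ^ p`. -/
def SchurLE (p : ℝ) (A : ℕ → ℕ → ℂ) (M : ℝ≥0∞) : Prop :=
  ∀ x y : EllTwo, NucLE p (fun j k => A j k * (x j * y k)) (M * (‖x‖ₑ * ‖y‖ₑ) ^ p)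

theorem SchurLE.mono {p : ℝ} {A : ℕ → ℕ → ℂ} {M N : ℝ≥0∞} (h : SchurLE p A M) (hMN : M ≤ N) :
    SchurLE p A N := fun x y => (h x y).mono (by gcongr)

theorem EllTwo.rpow_enorm_mul_ne_top {p : ℝ} (hp0 : 0 < p) (x y : EllTwo) :
    (‖x‖ₑ * ‖y‖ₑ) ^ p ≠ ⊤ :=
  ENNReal.rpow_ne_top_of_nonneg hp0.le (ENNReal.mul_ne_top (by simp) (by simp))

/-- Decompose `B` into rank one terms, multiply each, and add the costs: this is where both halves
of the `p`-nuclear description of `S_p` are used. -/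
theorem SchurLE.isSchurMultiplier {p : ℝ} (hp0 : 0 < p) (hp1 : p < 1) {A : ℕ → ℕ → ℂ} {M : ℝ≥0∞}
    (hM : M ≠ ⊤) (h : SchurLE p A M) : IsSchurMultiplier p (Matrix.of A) := by
  intro B hB
  obtain ⟨c, hc, x, y, hxy, hcost⟩ := hB.exists_nucLE hp0 hp1.le
  have hle : ∑' i, M * (‖x i‖ₑ * ‖y i‖ₑ) ^ p ≠ ⊤ := by
    rw [ENNReal.tsum_mul_left]
    exact ENNReal.mul_ne_top hM (ne_top_of_le_ne_top hc hcost)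
  exact (nucLE_tsum hp0 hp1.le (fun i => h (x i) (y i)) hle
    (a := fun j k => A j k * matrixOf B j k) fun j k => (hxy j k).mul_left _).exists_memSchatten
      hp0 hp1 hle

theorem schurLE_sum {ι : Type*} {p : ℝ} (hp0 : 0 < p) (hp1 : p ≤ 1) (s : Finset ι)
    {A : ι → ℕ → ℕ → ℂ} {M : ι → ℝ≥0∞} (hM : ∀ i ∈ s, M i ≠ ⊤)
    (h : ∀ i ∈ s, SchurLE p (A i) (M i)) :
    SchurLE p (fun j k => ∑ i ∈ s, A i j k) (∑ i ∈ s, M i) := by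
  intro x y
  have h1 : ∑' i : s, M i * (‖x‖ₑ * ‖y‖ₑ) ^ p = (∑ i ∈ s, M i) * (‖x‖ₑ * ‖y‖ₑ) ^ p := by
    rw [ENNReal.tsum_mul_right, Finset.tsum_subtype]
  rw [← h1]
  refine nucLE_tsum hp0 hp1 (fun i : s => h i i.2 x y) ?_ fun j k => ?_
  · rw [h1]
    exact ENNReal.mul_ne_top (ENNReal.sum_ne_top.2 hM) (EllTwo.rpow_enorm_mul_ne_top hp0 x y)
  · rw [Finset.sum_mul, ← Finset.sum_coe_sort]
    exact hasSum_fintype _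

theorem SchurLE.add {p : ℝ} (hp0 : 0 < p) (hp1 : p ≤ 1) {A B : ℕ → ℕ → ℂ} {M N : ℝ≥0∞}
    (hM : M ≠ ⊤) (hN : N ≠ ⊤) (hA : SchurLE p A M) (hB : SchurLE p B N) :
    SchurLE p (fun j k => A j k + B j k) (M + N) := by
  have := schurLE_sum hp0 hp1 (Finset.univ : Finset (Fin 2)) (A := ![A, B]) (M := ![M, N])
    (by simp [Fin.forall_fin_two, hM, hN]) (by simp [Fin.forall_fin_two, hA, hB])
  simpa [Fin.sum_univ_two] using this

theorem schurLE_rankOne {p : ℝ} (hp0 : 0 < p) (c : ℂ) {u w : ℕ → ℂ} (hu : ∀ j, ‖u j‖ ≤ 1)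
    (hw : ∀ j, ‖w j‖ ≤ 1) : SchurLE p (fun j k => c * (u j * w k)) (‖c‖ₑ ^ p) := by
  intro x y
  have h := nucLE_rankOne hp0 (c • EllTwo.mul u hu x) (EllTwo.mul w hw y)
  have hle : (‖c • EllTwo.mul u hu x‖ₑ * ‖EllTwo.mul w hw y‖ₑ) ^ p ≤
      ‖c‖ₑ ^ p * (‖x‖ₑ * ‖y‖ₑ) ^ p := by
    rw [← ENNReal.mul_rpow_of_nonneg _ _ hp0.le, enorm_smul, ← mul_assoc]
    gcongr
    · exact EllTwo.enorm_mul_le u hu x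
    · exact EllTwo.enorm_mul_le w hw y
  refine NucLE.mono ?_ hle
  convert! h using 3 with j k
  simp only [lp.coeFn_smul, Pi.smul_apply, EllTwo.mul_apply, smul_eq_mul]
  ring

theorem SchurLE.transpose {p : ℝ} {A : ℕ → ℕ → ℂ} {M : ℝ≥0∞} (h : SchurLE p A M) :
    SchurLE p (fun j k => A k j) M := by
  intro x y
  obtain ⟨x', y', h1, h2⟩ := h y x
  refine ⟨y', x', fun j k => ?_, ?_⟩
  · simpa only [mul_comm] using h1 k j
  · simpa only [mul_comm] using h2

/-! ### Gluing multipliers with disjoint supports -/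

theorem ENNReal.tsum_mul_le_Lp_mul_Lq {ι : Type*} (f g : ι → ℝ≥0∞) {p q : ℝ}
    (hpq : p.HolderConjugate q) :
    ∑' i, f i * g i ≤ (∑' i, f i ^ p) ^ (1 / p) * (∑' i, g i ^ q) ^ (1 / q) := by
  rw [ENNReal.tsum_eq_iSup_sum]
  refine iSup_le fun s => (ENNReal.inner_le_Lp_mul_Lq s f g hpq).trans ?_
  have := hpq.one_div_nonneg
  have := hpq.symm.one_div_nonneg
  gcongr <;> exact ENNReal.sum_le_tsum s

/-- Multipliers supported on blocks with pairwise disjoint rows and pairwise disjoint columns. -/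
theorem schurLE_blockDiagonal {ι : Type*} [Countable ι] {p : ℝ} (hp0 : 0 < p) (hp1 : p < 1)
    {A : ι → ℕ → ℕ → ℂ} {a : ℕ → ℕ → ℂ} {M : ι → ℝ≥0∞} {I J : ι → Set ℕ}
    (hI : Pairwise (Function.onFun Disjoint I)) (hJ : Pairwise (Function.onFun Disjoint J))
    (hAI : ∀ l j k, A l j k ≠ 0 → j ∈ I l) (hAJ : ∀ l j k, A l j k ≠ 0 → k ∈ J l)
    (hA : ∀ l, SchurLE p (A l) (M l)) (hM : ∑' l, M l ^ (1 / (1 - p)) ≠ ⊤)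
    (ha : ∀ j k, HasSum (fun l => A l j k) (a j k)) :
    SchurLE p a ((∑' l, M l ^ (1 / (1 - p))) ^ (1 - p)) := by
  intro x y
  have h1p : 0 < 1 - p := by linarith
  have hcost : ∑' l, M l * (‖EllTwo.restrict (I l) x‖ₑ * ‖EllTwo.restrict (J l) y‖ₑ) ^ p ≤
      (∑' l, M l ^ (1 / (1 - p))) ^ (1 - p) * (‖x‖ₑ * ‖y‖ₑ) ^ p := by
    -- Hölder with these exponents leaves the sum of products of the norms of the pieces of `x` and
    -- `y`; Cauchy–Schwarz then uses disjointness on both sides.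
    have hpq : (1 / (1 - p)).HolderConjugate (1 / p) := by
      rw [Real.holderConjugate_iff]
      refine ⟨?_, by simp⟩
      rw [lt_div_iff₀ h1p]; linarith
    refine (ENNReal.tsum_mul_le_Lp_mul_Lq _ _ hpq).trans ?_
    simp only [one_div_one_div]
    gcongr
    simp_rw [← ENNReal.rpow_mul, mul_one_div_cancel hp0.ne', ENNReal.rpow_one]
    refine (ENNReal.tsum_mul_le_Lp_mul_Lq _ _ Real.HolderConjugate.two_two).trans ?_
    simp only [ENNReal.rpow_two]
    have hroot : ∀ b : ℝ≥0∞, (b ^ 2) ^ (1 / 2 : ℝ) = b := by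
      intro b
      rw [← ENNReal.rpow_two, ← ENNReal.rpow_mul]
      norm_num
    calc _ ≤ (‖x‖ₑ ^ 2) ^ (1 / 2 : ℝ) * (‖y‖ₑ ^ 2) ^ (1 / 2 : ℝ) := by
          gcongr
          · exact EllTwo.tsum_enorm_restrict_sq_le hI x
          · exact EllTwo.tsum_enorm_restrict_sq_le hJ y
      _ = _ := by rw [hroot, hroot]
  refine (nucLE_tsum hp0 hp1.le (fun l => hA l (EllTwo.restrict (I l) x)
    (EllTwo.restrict (J l) y)) ?_ fun j k => ?_).mono hcost
  · refine ne_top_of_le_ne_top ?_ hcost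
    exact ENNReal.mul_ne_top (ENNReal.rpow_ne_top_of_nonneg h1p.le hM)
      (EllTwo.rpow_enorm_mul_ne_top hp0 x y)
  · convert! (ha j k).mul_right (x j * y k) using 2 with l
    by_cases h : A l j k = 0
    · simp [h]
    · rw [EllTwo.restrict_apply_of_mem _ (hAI l j k h),
        EllTwo.restrict_apply_of_mem _ (hAJ l j k h)]

/-- Multipliers supported on blocks with pairwise disjoint columns. -/
theorem schurLE_disjointColumns {ι : Type*} [Countable ι] {p : ℝ} (hp0 : 0 < p) (hp1 : p < 1)
    {A : ι → ℕ → ℕ → ℂ} {a : ℕ → ℕ → ℂ} {M : ι → ℝ≥0∞} {J : ι → Set ℕ}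
    (hJ : Pairwise (Function.onFun Disjoint J)) (hAJ : ∀ l j k, A l j k ≠ 0 → k ∈ J l)
    (hA : ∀ l, SchurLE p (A l) (M l)) (hM : ∑' l, M l ^ (2 / (2 - p)) ≠ ⊤)
    (ha : ∀ j k, HasSum (fun l => A l j k) (a j k)) :
    SchurLE p a ((∑' l, M l ^ (2 / (2 - p))) ^ ((2 - p) / 2)) := by
  intro x y
  have h2p : 0 < 2 - p := by linarith
  have hcost : ∑' l, M l * (‖x‖ₑ * ‖EllTwo.restrict (J l) y‖ₑ) ^ p ≤
      (∑' l, M l ^ (2 / (2 - p))) ^ ((2 - p) / 2) * (‖x‖ₑ * ‖y‖ₑ) ^ p := by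
    -- Only `y` is cut into orthogonal pieces, so the available quantity is the sum of squares of
    -- their norms, and `2 / p` is the exponent that produces it.
    have hpq : (2 / (2 - p)).HolderConjugate (2 / p) := by
      rw [Real.holderConjugate_iff]
      refine ⟨?_, ?_⟩
      · rw [lt_div_iff₀ h2p]; linarith
      · rw [inv_div, inv_div]; ring
    have hmul : ∀ l, M l * (‖x‖ₑ * ‖EllTwo.restrict (J l) y‖ₑ) ^ p =
        ‖x‖ₑ ^ p * (M l * ‖EllTwo.restrict (J l) y‖ₑ ^ p) := by
      intro l
      rw [ENNReal.mul_rpow_of_nonneg _ _ hp0.le]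
      ring
    simp_rw [hmul]
    rw [ENNReal.tsum_mul_left, ENNReal.mul_rpow_of_nonneg _ _ hp0.le, mul_left_comm]
    gcongr
    refine (ENNReal.tsum_mul_le_Lp_mul_Lq _ _ hpq).trans ?_
    simp only [one_div_div]
    gcongr
    simp_rw [← ENNReal.rpow_mul, mul_div_cancel₀ (2 : ℝ) hp0.ne', ENNReal.rpow_two]
    calc _ ≤ (‖y‖ₑ ^ 2) ^ (p / 2) := by
          gcongr
          exact EllTwo.tsum_enorm_restrict_sq_le hJ y
      _ = _ := by
          rw [← ENNReal.rpow_two, ← ENNReal.rpow_mul, mul_div_cancel₀ p (two_ne_zero)]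
  refine (nucLE_tsum hp0 hp1.le (fun l => hA l x (EllTwo.restrict (J l) y)) ?_
    fun j k => ?_).mono hcost
  · refine ne_top_of_le_ne_top ?_ hcost
    exact ENNReal.mul_ne_top (ENNReal.rpow_ne_top_of_nonneg (by positivity) hM)
      (EllTwo.rpow_enorm_mul_ne_top hp0 x y)
  · convert! (ha j k).mul_right (x j * y k) using 2 with l
    by_cases h : A l j k = 0
    · simp [h]
    · rw [EllTwo.restrict_apply_of_mem _ (hAJ l j k h)]

/-! ### Hankel matrices of trigonometric polynomials -/

/-- The trigonometric polynomial with coefficients `c` and spectrum in `S`. -/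
noncomputable def trigPoly (c : ℕ → ℂ) (S : Finset ℕ) (t : UnitAddCircle) : ℂ :=
  ∑ n ∈ S, c n * fourier (n : ℤ) t

theorem continuous_trigPoly (c : ℕ → ℂ) (S : Finset ℕ) : Continuous (trigPoly c S) :=
  continuous_finsetSum _ fun _ _ => continuous_const.mul (map_continuous _)

theorem fourier_apply_add (n : ℤ) (s t : UnitAddCircle) :
    fourier n (s + t) = fourier n s * fourier n t := by
  simp only [fourier_apply, smul_add, AddCircle.toCircle_add, Circle.coe_mul]

/-- The points of order dividing `N` of the circle. -/
noncomputable def circleNode (N l : ℕ) : UnitAddCircle := ((l / N : ℝ) : UnitAddCircle)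

theorem sum_fourier_circleNode {N : ℕ} (hN : N ≠ 0) {d : ℤ} (hd : |d| < N) :
    ∑ l ∈ Finset.range N, fourier d (circleNode N l) = if d = 0 then (N : ℂ) else 0 := by
  have hζ := Complex.isPrimitiveRoot_exp N hN
  set ζ := Complex.exp (2 * Real.pi * Complex.I / N)
  have h : ∀ l : ℕ, fourier d (circleNode N l) = (ζ ^ d) ^ l := by
    intro l
    rw [circleNode, fourier_coe_apply, ← Complex.exp_int_mul, ← Complex.exp_nat_mul]
    congr 1
    push_cast
    field_simp
  simp_rw [h]
  split_ifs with h0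
  · simp [h0]
  · have hne : ζ ^ d ≠ 1 := by
      rw [Ne, hζ.zpow_eq_one_iff_dvd]
      intro hdvd
      exact h0 (Int.eq_zero_of_abs_lt_dvd hdvd hd)
    rw [geom_sum_eq hne, ← zpow_natCast, ← zpow_mul, mul_comm, zpow_mul, zpow_natCast,
      hζ.pow_eq_one, one_zpow, sub_self, zero_div]

/-- By translation invariance the right side is the mean of the left side over `τ`, and some value
does not exceed the mean. This replaces a sampling inequality. -/
theorem exists_sum_enorm_translate_le {p : ℝ} {f : UnitAddCircle → ℂ} (hf : Continuous f)
    (N : ℕ) (s : ℕ → UnitAddCircle) :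
    ∃ τ : UnitAddCircle, ∑ l ∈ Finset.range N, ‖f (τ + s l)‖ₑ ^ p ≤
      N * ∫⁻ t, ‖f t‖ₑ ^ p ∂AddCircle.haarAddCircle := by
  have hmeas : ∀ l, Measurable fun τ => ‖f (τ + s l)‖ₑ ^ p := fun l =>
    ((hf.comp (continuous_add_const _)).measurable.enorm).pow_const p
  obtain ⟨τ, hτ⟩ := MeasureTheory.exists_le_lintegral (μ := AddCircle.haarAddCircle)
    (f := fun τ => ∑ l ∈ Finset.range N, ‖f (τ + s l)‖ₑ ^ p)
    (Finset.measurable_sum _ fun l _ => hmeas l).aemeasurable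
  refine ⟨τ, hτ.trans (le_of_eq ?_)⟩
  rw [MeasureTheory.lintegral_finsetSum _ fun l _ => hmeas l]
  simp_rw [MeasureTheory.lintegral_add_right_eq_self (μ := AddCircle.haarAddCircle)
    (fun t => ‖f t‖ₑ ^ p)]
  simp

open Classical in
/-- The block of a Hankel matrix with rows in `I`, columns in `J` and spectrum in `S`. -/
noncomputable def hankelBlock (c : ℕ → ℂ) (S : Finset ℕ) (I J : Set ℕ) (i j : ℕ) : ℂ :=
  if i ∈ I ∧ j ∈ J ∧ i + j ∈ S then c (i + j) else 0

open Classical in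
/-- A block of a Hankel matrix whose symbol has its spectrum close to the sums of the indices of
the block. -/
theorem schurLE_hankelBlock {p : ℝ} (hp0 : 0 < p) (hp1 : p ≤ 1) (c : ℕ → ℂ) (S : Finset ℕ)
    (I J : Set ℕ) {N : ℕ} (hN : N ≠ 0)
    (hIJ : ∀ i ∈ I, ∀ j ∈ J, ∀ n ∈ S, |(n : ℤ) - (i + j)| < N) :
    SchurLE p (hankelBlock c S I J)
      ((N : ℝ≥0∞) ^ (1 - p) *
        ∫⁻ t, ‖trigPoly c S t‖ₑ ^ p ∂AddCircle.haarAddCircle) := by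
  obtain ⟨τ, hτ⟩ := exists_sum_enorm_translate_le (p := p) (continuous_trigPoly c S) N
    (circleNode N)
  let f := trigPoly c S
  let z : ℕ → UnitAddCircle := fun l => τ + circleNode N l
  let u : Set ℕ → ℕ → ℕ → ℂ := fun I l i => if i ∈ I then fourier (-(i : ℤ)) (z l) else 0
  have hfn : ∀ (n : ℤ) (t : UnitAddCircle), ‖fourier n t‖ = 1 := fun n t => Circle.norm_coe _
  have hu : ∀ I l i, ‖u I l i‖ ≤ 1 := by
    intro I l i
    simp only [u]
    split_ifs
    · exact (hfn _ _).le
    · simp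
  have hN0 : (N : ℂ) ≠ 0 := by exact_mod_cast hN
  have hNe : (N : ℝ≥0∞) ≠ 0 := by exact_mod_cast hN
  -- Discrete Fourier inversion: since `|n - (i + j)| < N`, summing over the nodes keeps only the
  -- frequency `n = i + j`, and the rotation `τ` cancels there.
  have hent : hankelBlock c S I J =
      fun i j => ∑ l ∈ Finset.range N, (f (z l) / N) * (u I l i * u J l j) := by
    funext i j
    rw [hankelBlock]
    by_cases hi : i ∈ I
    swap
    · simp [u, hi]
    by_cases hj : j ∈ J
    swap
    · simp [u, hj]
    have h1 : ∀ l, (f (z l) / N) * (u I l i * u J l j) =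
        ∑ n ∈ S, c n / N * fourier ((n : ℤ) - (i + j)) τ *
          fourier ((n : ℤ) - (i + j)) (circleNode N l) := by
      intro l
      simp only [u, hi, hj, if_true, f, trigPoly]
      rw [Finset.sum_div, Finset.sum_mul]
      refine Finset.sum_congr rfl fun n _ => ?_
      rw [mul_assoc, ← fourier_apply_add, sub_eq_add_neg, neg_add, fourier_add, fourier_add]
      ring
    simp_rw [h1]
    rw [Finset.sum_comm]
    have h2 : ∀ n ∈ S, ∑ l ∈ Finset.range N, c n / N * fourier ((n : ℤ) - (i + j)) τ *
        fourier ((n : ℤ) - (i + j)) (circleNode N l) = if n = i + j then c n else 0 := by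
      intro n hn
      rw [← Finset.mul_sum, sum_fourier_circleNode hN (hIJ i hi j hj n hn)]
      by_cases h : n = i + j
      · simp [h, hN0]
      · have : ¬ ((n : ℤ) - (i + j) = 0) := by omega
        simp [h, this]
    rw [Finset.sum_congr rfl h2]
    simp [hi, hj]
  have hcost : ∑ l ∈ Finset.range N, ‖f (z l) / N‖ₑ ^ p ≤
      (N : ℝ≥0∞) ^ (1 - p) * ∫⁻ t, ‖f t‖ₑ ^ p ∂AddCircle.haarAddCircle := by
    have h1 : ∀ l, ‖f (z l) / N‖ₑ ^ p = (N : ℝ≥0∞) ^ (-p) * ‖f (z l)‖ₑ ^ p := by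
      intro l
      rw [div_eq_mul_inv, enorm_mul, ENNReal.mul_rpow_of_nonneg _ _ hp0.le, mul_comm, enorm_inv hN0,
        ENNReal.inv_rpow, ENNReal.rpow_neg]
      congr 3
      rw [← ofReal_norm]
      simp
    simp_rw [h1]
    rw [← Finset.mul_sum]
    calc _ ≤ (N : ℝ≥0∞) ^ (-p) * (N * ∫⁻ t, ‖f t‖ₑ ^ p ∂AddCircle.haarAddCircle) := by
          gcongr
      _ = _ := by
          rw [← mul_assoc, sub_eq_neg_add, ENNReal.rpow_add _ _ hNe (by simp), ENNReal.rpow_one]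
  rw [hent]
  refine (schurLE_sum hp0 hp1 (Finset.range N) (M := fun l => ‖f (z l) / N‖ₑ ^ p) ?_
    fun l _ => schurLE_rankOne hp0 _ (hu I l) (hu J l)).mono hcost
  intro l _
  exact ENNReal.rpow_ne_top_of_nonneg hp0.le (by simp)

/-- Lacunary spectral intervals `[lower k, upper (k + 1))` that are short compared with their
distance from the origin. -/
structure IsLacunary (lower upper : ℕ → ℕ) : Prop where
  pos : 0 < upper 0
  le : ∀ k, lower k ≤ upper (k + 1)
  -- The inequality `(upper (k + 1) - lower k + upper k) / upper (k + 1) < 1 / 8` with denominators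
  -- and subtraction cleared.
  gap : ∀ k, 8 * (upper (k + 1) + upper k) < upper (k + 1) + 8 * lower k

namespace IsLacunary

variable {lower upper : ℕ → ℕ}

theorem eight_mul_lt (h : IsLacunary lower upper) (k : ℕ) : 8 * upper k < upper (k + 1) := by
  have := h.gap k
  have := h.le k
  omega

theorem seven_mul_lt (h : IsLacunary lower upper) (k : ℕ) : 7 * upper k < lower k := by
  have := h.gap k
  have := h.eight_mul_lt k
  omega

theorem monotone (h : IsLacunary lower upper) : Monotone upper :=
  monotone_nat_of_le_succ fun k => by have := h.eight_mul_lt k; omega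

theorem upper_pos (h : IsLacunary lower upper) (k : ℕ) : 0 < upper k :=
  h.pos.trans_le (h.monotone (Nat.zero_le k))

/-- Earlier intervals end by `upper k`, and later ones start beyond `7 * upper (k + 1)`. The margin
`4` is what the three dyadic windows around the `k`-th interval require. -/
theorem eq_of_lt (h : IsLacunary lower upper) {j k l : ℕ} (h1 : upper k < j)
    (h2 : j ≤ 4 * upper (k + 1)) (h3 : j ∈ Finset.Ico (lower l) (upper (l + 1))) : l = k := by
  rw [Finset.mem_Ico] at h3
  rcases lt_trichotomy l k with hlk | hlk | hlk
  · have := h.monotone (show l + 1 ≤ k from hlk)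
    omega
  · exact hlk
  · have := h.monotone (show k + 1 ≤ l from hlk)
    have := h.seven_mul_lt l
    omega

theorem unique (h : IsLacunary lower upper) {j k l : ℕ}
    (h1 : j ∈ Finset.Ico (lower k) (upper (k + 1)))
    (h2 : j ∈ Finset.Ico (lower l) (upper (l + 1))) : l = k := by
  have h3 := h.seven_mul_lt k
  have h4 := Finset.mem_Ico.1 h1
  exact h.eq_of_lt (by omega) (by omega) h2

end IsLacunary

/-- The part of a Hankel matrix with spectrum in `[a, b)` whose rows precede `r`. -/
noncomputable def hankelCorner (c : ℕ → ℂ) (a b r : ℕ) : ℕ → ℕ → ℂ :=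
  hankelBlock c (Finset.Ico a b) (Set.Iio r) (Set.Ico (a - r) b)

/-- The part of a Hankel matrix with spectrum in `[a, b)` whose rows and columns start at `r`. -/
noncomputable def hankelMiddle (c : ℕ → ℂ) (a b r : ℕ) : ℕ → ℕ → ℂ :=
  hankelBlock c (Finset.Ico a b) (Set.Ico r b) (Set.Ico r b)

theorem hankelCorner_add_middle_add_corner (c : ℕ → ℂ) {a b r : ℕ} (h : 2 * r ≤ a) (i j : ℕ) :
    hankelMiddle c a b r i j + hankelCorner c a b r i j + hankelCorner c a b r j i =
      if i + j ∈ Finset.Ico a b then c (i + j) else 0 := by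
  simp only [hankelMiddle, hankelCorner, hankelBlock, Set.mem_Iio, Set.mem_Ico, Finset.mem_Ico,
    add_comm j i]
  by_cases h1 : a ≤ i + j ∧ i + j < b
  · by_cases hi : i < r
    · have h2 : ¬ j < r := by omega
      have h3 : ¬ r ≤ i := by omega
      have h4 : a ≤ j + r := by omega
      have h5 : j < b := by omega
      simp [h1, hi, h2, h3, h4, h5]
    · by_cases hj : j < r
      · have h3 : ¬ r ≤ j := by omega
        have h4 : a ≤ i + r := by omega
        have h5 : i < b := by omega
        simp [h1, hi, hj, h3, h4, h5]
      · have h3 : r ≤ i := by omega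
        have h4 : r ≤ j := by omega
        have h5 : i < b := by omega
        have h6 : j < b := by omega
        simp [h1, hi, hj, h3, h4, h5, h6]
  · simp [h1]

/-! ### Assembling the lacunary Hankel matrix -/

theorem lintegral_trigPoly_rpow_ne_top {p : ℝ} (hp0 : 0 < p) (c : ℕ → ℂ) (S : Finset ℕ) :
    ∫⁻ t, ‖trigPoly c S t‖ₑ ^ p ∂AddCircle.haarAddCircle ≠ ⊤ := by
  have hle : ∀ t, ‖trigPoly c S t‖ₑ ^ p ≤ (∑ n ∈ S, ‖c n‖ₑ) ^ p := by
    intro t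
    refine ENNReal.rpow_le_rpow ((enorm_sum_le _ _).trans (Finset.sum_le_sum fun n _ => ?_)) hp0.le
    rw [enorm_mul]
    have : ‖fourier (n : ℤ) t‖ₑ = 1 := by
      rw [← ofReal_norm, show ‖fourier (n : ℤ) t‖ = 1 from Circle.norm_coe _, ENNReal.ofReal_one]
    rw [this, mul_one]
  refine ne_top_of_le_ne_top ?_ (MeasureTheory.lintegral_mono hle)
  rw [MeasureTheory.lintegral_const, MeasureTheory.measure_univ, mul_one]
  exact ENNReal.rpow_ne_top_of_nonneg hp0.le (ENNReal.sum_ne_top.2 fun _ _ => by simp)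

/-- Young's inequality in crude form: `z` dominates both summands, and the exponents satisfy `p / 2
+ (1 - p) = (2 - p) / 2`. It trades the smallness of a corner against its Besov cost. -/
theorem ENNReal.rpow_mul_le_add {p : ℝ} (hp0 : 0 < p) (hp1 : p < 1) (x y : ℝ≥0∞) :
    (x ^ (1 - p) * y) ^ (2 / (2 - p)) ≤ x ^ (2 * (1 - p) / p) + y ^ (1 / (1 - p)) := by
  have h1p : 0 < 1 - p := by linarith
  have h2p : 0 < 2 - p := by linarith
  set z := x ^ (2 * (1 - p) / p) + y ^ (1 / (1 - p))
  have hx : x ^ (1 - p) ≤ z ^ (p / 2) := by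
    calc x ^ (1 - p) = (x ^ (2 * (1 - p) / p)) ^ (p / 2) := by
          rw [← ENNReal.rpow_mul]; congr 1; field_simp
      _ ≤ _ := ENNReal.rpow_le_rpow le_self_add (by positivity)
  have hy : y ≤ z ^ (1 - p) := by
    calc y = (y ^ (1 / (1 - p))) ^ (1 - p) := by
          rw [← ENNReal.rpow_mul, one_div_mul_cancel h1p.ne', ENNReal.rpow_one]
      _ ≤ _ := ENNReal.rpow_le_rpow le_add_self h1p.le
  calc (x ^ (1 - p) * y) ^ (2 / (2 - p)) ≤ (z ^ (p / 2) * z ^ (1 - p)) ^ (2 / (2 - p)) := by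
        gcongr
    _ = z := by
        rw [← ENNReal.rpow_add_of_nonneg _ _ (by positivity) h1p.le, ← ENNReal.rpow_mul]
        have : (p / 2 + (1 - p)) * (2 / (2 - p)) = 1 := by field_simp; ring
        rw [this, ENNReal.rpow_one]

open Classical in
theorem exists_schurLE_hankel {p : ℝ} (hp0 : 0 < p) (hp1 : p < 1) {c : ℕ → ℂ}
    {lower upper : ℕ → ℕ} (h : IsLacunary lower upper)
    (hc : ∀ j, upper 0 ≤ j → c j ≠ 0 → ∃ k, j ∈ Finset.Ico (lower k) (upper (k + 1)))
    (hε : ∑' k, (((upper (k + 1) - lower k + upper k : ℕ) : ℝ≥0∞) / (upper (k + 1) : ℝ≥0∞)) ^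
      (2 * (1 - p) / p) ≠ ⊤)
    (hP : ∑' k, ((upper (k + 1) : ℝ≥0∞) ^ (1 - p) *
      ∫⁻ t, ‖trigPoly c (Finset.Ico (lower k) (upper (k + 1))) t‖ₑ ^ p
        ∂AddCircle.haarAddCircle) ^ (1 / (1 - p)) ≠ ⊤) :
    ∃ M : ℝ≥0∞, M ≠ ⊤ ∧ SchurLE p (fun i j => c (i + j)) M := by
  have h1p : 0 < 1 - p := by linarith
  have h2p : 0 < 2 - p := by linarith
  let S : ℕ → Finset ℕ := fun k => Finset.Ico (lower k) (upper (k + 1))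
  let P : ℕ → ℝ≥0∞ := fun k => ∫⁻ t, ‖trigPoly c (S k) t‖ₑ ^ p ∂AddCircle.haarAddCircle
  let a : ℕ → ℝ≥0∞ := fun k => (upper (k + 1) : ℝ≥0∞) ^ (1 - p) * P k
  let mid : ℕ → ℕ → ℕ → ℂ := fun k => hankelMiddle c (lower k) (upper (k + 1)) (upper k)
  let cor : ℕ → ℕ → ℕ → ℂ := fun k => hankelCorner c (lower k) (upper (k + 1)) (upper k)
  let m : ℕ → ℕ := fun k => upper (k + 1) - lower k + upper k
  let R : ℕ → Set ℕ := fun k => Set.Ico (upper k) (upper (k + 1))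
  have hR : Pairwise (Function.onFun Disjoint R) := h.monotone.pairwise_disjoint_on_Ico_succ
  -- The spectral intervals are disjoint, so at most one `k` contributes to a given entry.
  have hsummable : ∀ (g : ℕ → ℂ) (j : ℕ), (∀ k, g k ≠ 0 → j ∈ S k) → Summable g := by
    intro g j hg
    refine summable_of_hasFiniteSupport (Set.Subsingleton.finite fun k hk l hl => ?_)
    exact h.unique (hg l hl) (hg k hk)
  have hmidS : ∀ i j k, mid k i j ≠ 0 → i + j ∈ S k := by
    intro i j k hne
    simp only [mid, hankelMiddle, hankelBlock, ne_eq, ite_eq_right_iff, Classical.not_imp] at hne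
    exact hne.1.2.2
  have hcorS : ∀ i j k, cor k i j ≠ 0 → i + j ∈ S k := by
    intro i j k hne
    simp only [cor, hankelCorner, hankelBlock, ne_eq, ite_eq_right_iff, Classical.not_imp] at hne
    exact hne.1.2.2
  have hmidsum : ∀ i j, Summable fun k => mid k i j := fun i j =>
    hsummable _ (i + j) (hmidS i j)
  have hcorsum : ∀ i j, Summable fun k => cor k i j := fun i j =>
    hsummable _ (i + j) (hcorS i j)
  have hmid : ∀ k, SchurLE p (mid k) (((2 * upper (k + 1) : ℕ) : ℝ≥0∞) ^ (1 - p) * P k) := by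
    intro k
    have := h.upper_pos (k + 1)
    refine schurLE_hankelBlock hp0 hp1.le c (S k) (R k) (R k) (N := 2 * upper (k + 1)) (by omega)
      fun i hi j hj n hn => ?_
    simp only [R, Set.mem_Ico, S, Finset.mem_Ico] at hi hj hn
    rw [abs_lt]
    push_cast
    omega
  -- In a corner `i + j` lies within `upper k` of the spectral interval, so its length plus `upper
  -- k` sampling points suffice.
  have hcor : ∀ k, SchurLE p (cor k) ((m k : ℝ≥0∞) ^ (1 - p) * P k) := by
    intro k
    have h1 := h.upper_pos k
    have h2 := h.seven_mul_lt k
    have h3 := h.le k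
    refine schurLE_hankelBlock hp0 hp1.le c (S k) (Set.Iio (upper k))
      (Set.Ico (lower k - upper k) (upper (k + 1))) (N := m k) (by simp only [m]; omega)
      fun i hi j hj n hn => ?_
    simp only [Set.mem_Ico, Set.mem_Iio, S, Finset.mem_Ico] at hi hj hn
    rw [abs_lt]
    simp only [m]
    omega
  have hMmid : ∑' k, (((2 * upper (k + 1) : ℕ) : ℝ≥0∞) ^ (1 - p) * P k) ^ (1 / (1 - p)) ≠ ⊤ := by
    have h1 : ∀ k, (((2 * upper (k + 1) : ℕ) : ℝ≥0∞) ^ (1 - p) * P k) ^ (1 / (1 - p)) =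
        2 * a k ^ (1 / (1 - p)) := by
      intro k
      rw [Nat.cast_mul, ENNReal.mul_rpow_of_nonneg _ _ h1p.le, mul_assoc,
        ENNReal.mul_rpow_of_nonneg _ _ (by positivity), ← ENNReal.rpow_mul,
        mul_one_div_cancel h1p.ne', ENNReal.rpow_one]
      rfl
    simp_rw [h1]
    rw [ENNReal.tsum_mul_left]
    exact ENNReal.mul_ne_top (by norm_num) hP
  have hMcor : ∑' k, ((m k : ℝ≥0∞) ^ (1 - p) * P k) ^ (2 / (2 - p)) ≠ ⊤ := by
    have h1 : ∀ k, ((m k : ℝ≥0∞) ^ (1 - p) * P k) ^ (2 / (2 - p)) ≤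
        ((m k : ℝ≥0∞) / (upper (k + 1) : ℝ≥0∞)) ^ (2 * (1 - p) / p) + a k ^ (1 / (1 - p)) := by
      intro k
      refine le_trans (le_of_eq ?_) (ENNReal.rpow_mul_le_add hp0 hp1 _ _)
      have hu : (upper (k + 1) : ℝ≥0∞) ≠ 0 := by exact_mod_cast (h.upper_pos (k + 1)).ne'
      rw [← mul_assoc, ← ENNReal.mul_rpow_of_nonneg _ _ h1p.le,
        ENNReal.div_mul_cancel hu (by simp)]
    refine ne_top_of_le_ne_top ?_ (ENNReal.tsum_le_tsum h1)
    rw [ENNReal.tsum_add]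
    exact ENNReal.add_ne_top.2 ⟨hε, hP⟩
  have hmidall := schurLE_blockDiagonal hp0 hp1 (I := R) (J := R) hR hR
    (fun k i j hne => by
      simp only [mid, hankelMiddle, hankelBlock, ne_eq, ite_eq_right_iff, Classical.not_imp] at hne
      exact hne.1.1)
    (fun k i j hne => by
      simp only [mid, hankelMiddle, hankelBlock, ne_eq, ite_eq_right_iff, Classical.not_imp] at hne
      exact hne.1.2.1) hmid hMmid fun i j => (hmidsum i j).hasSum
  -- Corner columns start at `lower k - upper k`, beyond `upper k`; they therefore lie in the
  -- disjoint intervals `R k`.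
  have hcorall := schurLE_disjointColumns hp0 hp1 (J := R) hR
    (fun k i j hne => by
      simp only [cor, hankelCorner, hankelBlock, ne_eq, ite_eq_right_iff, Classical.not_imp] at hne
      have h1 := h.seven_mul_lt k
      have h2 := hne.1.2.1
      simp only [Set.mem_Ico, R] at h2 ⊢
      omega) hcor hMcor fun i j => (hcorsum i j).hasSum
  -- The remaining entries, with `i + j < upper 0`, form a finite matrix.
  have hfin := schurLE_hankelBlock hp0 hp1.le c (Finset.range (upper 0)) (Set.Iio (upper 0))
    (Set.Iio (upper 0)) (N := 2 * upper 0) (by have := h.pos; omega) fun i hi j hj n hn => by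
      simp only [Set.mem_Iio, Finset.mem_range] at hi hj hn
      rw [abs_lt]
      push_cast
      omega
  have htopmid := ENNReal.rpow_ne_top_of_nonneg h1p.le hMmid
  have htopcor := ENNReal.rpow_ne_top_of_nonneg (show 0 ≤ (2 - p) / 2 by positivity) hMcor
  have htopfin : ((2 * upper 0 : ℕ) : ℝ≥0∞) ^ (1 - p) *
      ∫⁻ t, ‖trigPoly c (Finset.range (upper 0)) t‖ₑ ^ p ∂AddCircle.haarAddCircle ≠ ⊤ :=
    ENNReal.mul_ne_top (ENNReal.rpow_ne_top_of_nonneg h1p.le (ENNReal.natCast_ne_top _))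
      (lintegral_trigPoly_rpow_ne_top hp0 _ _)
  have htop1 := ENNReal.add_ne_top.2 ⟨htopmid, htopcor⟩
  have htop2 := ENNReal.add_ne_top.2 ⟨htop1, htopcor⟩
  refine ⟨_, ENNReal.add_ne_top.2 ⟨htop2, htopfin⟩, ?_⟩
  have hall := (((hmidall.add hp0 hp1.le htopmid htopcor hcorall).add hp0 hp1.le htop1 htopcor
    hcorall.transpose).add hp0 hp1.le htop2 htopfin hfin)
  convert! hall using 1
  funext i j
  have hsum : ∑' k, mid k i j + ∑' k, cor k i j + ∑' k, cor k j i =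
      ∑' k, if i + j ∈ S k then c (i + j) else 0 := by
    rw [← (hmidsum i j).tsum_add (hcorsum i j),
      ← ((hmidsum i j).add (hcorsum i j)).tsum_add (hcorsum j i)]
    refine tsum_congr fun k => ?_
    have := h.seven_mul_lt k
    exact hankelCorner_add_middle_add_corner c (by omega) i j
  rw [hsum]
  by_cases h0 : i + j < upper 0
  · have h1 : ∀ k, i + j ∉ S k := by
      intro k hk
      have h2 := h.seven_mul_lt k
      have h3 := h.monotone (Nat.zero_le k)
      simp only [S, Finset.mem_Ico] at hk
      omega
    have h2 : i < upper 0 := by omega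
    have h3 : j < upper 0 := by omega
    simp [hankelBlock, h1, h0, h2, h3]
  · have h2 : ¬ (i ∈ Set.Iio (upper 0) ∧ j ∈ Set.Iio (upper 0) ∧
        i + j ∈ Finset.range (upper 0)) := by
      simp [h0]
    rw [hankelBlock, if_neg h2, add_zero]
    by_cases hcz : c (i + j) = 0
    · simp [hcz]
    · obtain ⟨k, hk⟩ := hc (i + j) (by omega) hcz
      rw [tsum_eq_single k]
      · rw [if_pos hk]
      · intro l hl
        rw [if_neg fun hl' => hl (h.unique hk hl')]

/-! ### Dyadic blocks -/

theorem IsDyadicWindow.eq_zero {v : ℝ → ℝ} (hv : IsDyadicWindow v) {x : ℝ}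
    (hx : x ∉ Set.Icc (1 / 2 : ℝ) 2) : v x = 0 := by
  rw [← hv.tsupport_eq] at hx
  exact image_eq_zero_of_notMem_tsupport hx

theorem IsDyadicWindow.bounds_of_ne_zero {v : ℝ → ℝ} (hv : IsDyadicWindow v) {n j : ℕ}
    (h : v (j / 2 ^ n) ≠ 0) : 2 ^ n ≤ 2 * j ∧ j ≤ 2 ^ (n + 1) := by
  have h1 : (j / 2 ^ n : ℝ) ∈ Set.Icc (1 / 2 : ℝ) 2 := by
    by_contra h'
    exact h (hv.eq_zero h')
  obtain ⟨h2, h3⟩ := h1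
  rw [le_div_iff₀ (by positivity)] at h2
  rw [div_le_iff₀ (by positivity)] at h3
  constructor
  · have : (2 : ℝ) ^ n ≤ 2 * j := by linarith
    exact_mod_cast this
  · rw [pow_succ, mul_comm]
    exact_mod_cast h3

theorem kernelCoeff_of_pos (v : ℝ → ℝ) {n : ℕ} (hn : 0 < n) (j : ℕ) :
    kernelCoeff v n j = v (j / 2 ^ n) := by
  simp [kernelCoeff, hn.ne']

/-- For `j` strictly between `2 ^ e` and `2 ^ (e + 2)` only the windows `e`, `e + 1`, `e + 2` can be
nonzero, so they carry the whole partition of unity. -/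
theorem sum_kernelCoeff_eq_one {v : ℝ → ℝ} (hv : IsDyadicWindow v) {e j : ℕ} (he : 0 < e)
    (h1 : 2 ^ e < j) (h2 : j < 2 ^ (e + 2)) :
    ∑ i ∈ Finset.range 3, kernelCoeff v (e + i) j = 1 := by
  have hj : (1 : ℝ) ≤ j := by
    have : 1 ≤ j := (Nat.one_le_two_pow).trans h1.le
    exact_mod_cast this
  have hsum := hv.hasSum_one j hj
  have h3 : ∀ n ∉ Finset.Ico e (e + 3), v ((j : ℝ) / 2 ^ n) = 0 := by
    intro n hn
    by_contra hne
    obtain ⟨h4, h5⟩ := hv.bounds_of_ne_zero hne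
    apply hn
    rw [Finset.mem_Ico]
    constructor
    · have := (Nat.pow_lt_pow_iff_right (a := 2) (by norm_num)).1 (h1.trans_le h5)
      omega
    · refine (Nat.pow_lt_pow_iff_right (a := 2) (by norm_num)).1 (h4.trans_lt ?_)
      rw [show e + 3 = e + 2 + 1 by ring, pow_succ]
      omega
  have h4 := (hasSum_sum_of_ne_finset_zero h3).unique hsum
  rw [Finset.sum_Ico_eq_sum_range, Nat.add_sub_cancel_left] at h4
  rw [← h4]
  exact Finset.sum_congr rfl fun i _ => kernelCoeff_of_pos v (by omega) j

theorem IsLacunary.exists_dyadic_index {lower upper : ℕ → ℕ} (h : IsLacunary lower upper) :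
    ∃ e : ℕ → ℕ, Function.Injective e ∧ ∀ k, 0 < e k ∧ 2 ^ (e k + 1) ≤ upper (k + 1) ∧
      upper (k + 1) < 2 ^ (e k + 2) := by
  have h8 : ∀ k, 8 < upper (k + 1) := fun k => by
    have := h.eight_mul_lt k
    have := h.upper_pos k
    omega
  have hex : ∀ k, ∃ e, 0 < e ∧ 2 ^ (e + 1) ≤ upper (k + 1) ∧ upper (k + 1) < 2 ^ (e + 2) := by
    intro k
    have h1 := Nat.pow_log_le_self 2 (x := upper (k + 1)) (by have := h8 k; omega)
    have h2 := Nat.lt_pow_succ_log_self (b := 2) (by norm_num) (upper (k + 1))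
    have h3 : 2 ≤ Nat.log 2 (upper (k + 1)) :=
      Nat.le_log_of_pow_le (by norm_num) (by have := h8 k; omega)
    refine ⟨Nat.log 2 (upper (k + 1)) - 1, by omega, ?_, ?_⟩
    · rwa [Nat.sub_add_cancel (by omega)]
    · rwa [show Nat.log 2 (upper (k + 1)) - 1 + 2 = (Nat.log 2 (upper (k + 1))).succ by omega]
  choose e he using hex
  refine ⟨e, StrictMono.injective (strictMono_nat_of_lt_succ fun k => ?_), he⟩
  have h1 := (he k).2.1
  have h2 := (he (k + 1)).2.2
  have h3 := h.eight_mul_lt (k + 1)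
  have h4 : 2 ^ (e k + 2) < 2 ^ (e (k + 1) + 2) := by
    rw [pow_succ 2 (e k + 1)]
    omega
  have := (Nat.pow_lt_pow_iff_right (a := 2) (by norm_num)).1 h4
  omega

/-- The three windows sum to `1` on the `k`-th interval, as `lower k` exceeds `7 / 8` of `upper (k +
1)`. Their support lies above `upper k` and at most at `4 * upper (k + 1)`, so no other part of the
spectrum enters. -/
theorem trigPoly_eq_sum_dyadicBlock {v : ℝ → ℝ} (hv : IsDyadicWindow v) {ψ : ℂ → ℂ}
    {lower upper : ℕ → ℕ} (h : IsLacunary lower upper)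
    (hc : ∀ j, upper 0 ≤ j → taylorCoeff ψ j ≠ 0 →
      ∃ k, j ∈ Finset.Ico (lower k) (upper (k + 1))) {e k : ℕ} (he : 0 < e)
    (h1 : 2 ^ (e + 1) ≤ upper (k + 1)) (h2 : upper (k + 1) < 2 ^ (e + 2)) (t : UnitAddCircle) :
    trigPoly (taylorCoeff ψ) (Finset.Ico (lower k) (upper (k + 1))) t =
      ∑ i ∈ Finset.range 3, dyadicBlock v ψ (e + i) t := by
  set S := Finset.Ico (lower k) (upper (k + 1))
  have hgap := h.gap k
  have hblock : ∀ i ∈ Finset.range 3, dyadicBlock v ψ (e + i) t =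
      ∑ j ∈ S, (kernelCoeff v (e + i) j : ℂ) * taylorCoeff ψ j * fourier (j : ℤ) t := by
    intro i hi
    rw [Finset.mem_range] at hi
    have hn : 0 < e + i := by omega
    refine Finset.sum_congr_of_eq_on_inter (fun j _ hj => ?_) (fun j _ hj => ?_) fun _ _ _ => rfl
    · by_contra hne
      have hc0 : taylorCoeff ψ j ≠ 0 := fun h0 => hne (by simp [h0])
      have hv0 : v (j / 2 ^ (e + i)) ≠ 0 := by
        rw [← kernelCoeff_of_pos v hn]
        exact fun h0 => hne (by simp [h0])
      obtain ⟨h3, h4⟩ := hv.bounds_of_ne_zero hv0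
      have h5 : 2 ^ e ≤ 2 ^ (e + i) := Nat.pow_le_pow_right (by norm_num) (by omega)
      have h6 : 2 ^ (e + i + 1) ≤ 2 ^ (e + 3) := Nat.pow_le_pow_right (by norm_num) (by omega)
      have h7 : 2 ^ (e + 3) = 8 * 2 ^ e := by ring
      have h8 : 2 ^ (e + 2) = 4 * 2 ^ e := by ring
      have h9 : 2 ^ (e + 1) = 2 * 2 ^ e := by ring
      have h10 := h.eight_mul_lt k
      have h11 := h.monotone (Nat.zero_le k)
      -- From `8 * upper k < upper (k + 1) < 4 * 2 ^ e ≤ 8 * j`.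
      have hlow : upper k < j := by omega
      obtain ⟨l, hl⟩ := hc j (by omega) hc0
      rw [h.eq_of_lt hlow (by omega) hl] at hl
      exact hj hl
    · have hv0 : v (j / 2 ^ (e + i)) = 0 := by
        by_contra hne
        have := (hv.bounds_of_ne_zero hne).2
        rw [Finset.mem_range] at hj
        omega
      simp [kernelCoeff_of_pos v hn, hv0]
  rw [Finset.sum_congr rfl hblock, Finset.sum_comm, trigPoly]
  refine Finset.sum_congr rfl fun j hj => ?_
  rw [Finset.mem_Ico] at hj
  rw [← Finset.sum_mul, ← Finset.sum_mul]
  have h3 : 2 ^ e < j := by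
    have : 2 ^ (e + 1) = 2 * 2 ^ e := by ring
    omega
  have := sum_kernelCoeff_eq_one hv he h3 (by omega)
  rw [← Complex.ofReal_sum, this, Complex.ofReal_one, one_mul]

theorem continuous_dyadicBlock (v : ℝ → ℝ) (ψ : ℂ → ℂ) (n : ℕ) : Continuous (dyadicBlock v ψ n) :=
  continuous_finsetSum _ fun _ _ => continuous_const.mul (map_continuous _)

theorem dyadicBlock_eq_trigPoly (v : ℝ → ℝ) (ψ : ℂ → ℂ) (n : ℕ) :
    dyadicBlock v ψ n = trigPoly (fun k => (kernelCoeff v n k : ℂ) * taylorCoeff ψ k)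
      (Finset.range (2 ^ (n + 1) + 1)) := rfl

/-- Raising the Besov terms to the power `p / (1 - p)` turns the weight into `2 ^ n` and the norm
into the integral to the power `1 / (1 - p)`. -/
theorem MemBesov.tsum_ne_top {v : ℝ → ℝ} {p : ℝ} {ψ : ℂ → ℂ} (hp0 : 0 < p) (hp1 : p < 1)
    (h : MemBesov v (1 / (p / (1 - p))) (ENNReal.ofReal p) (ENNReal.ofReal (p / (1 - p))) ψ) :
    ∑' n : ℕ, 2 ^ n * (∫⁻ t, ‖dyadicBlock v ψ n t‖ₑ ^ p ∂AddCircle.haarAddCircle) ^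
      (1 / (1 - p)) ≠ ⊤ := by
  have h1p : 0 < 1 - p := by linarith
  have hq : 0 < p / (1 - p) := by positivity
  rw [MemBesov, memℓp_gen_iff (by rwa [ENNReal.toReal_ofReal hq.le]),
    ENNReal.toReal_ofReal hq.le] at h
  refine ne_of_eq_of_ne (tsum_congr fun n => ?_) h.tsum_ofReal_ne_top
  set Q := ∫⁻ t, ‖dyadicBlock v ψ n t‖ₑ ^ p ∂AddCircle.haarAddCircle
  have hQ : Q ≠ ⊤ := by
    simp only [Q, dyadicBlock_eq_trigPoly]
    exact lintegral_trigPoly_rpow_ne_top hp0 _ _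
  have hnorm : MeasureTheory.eLpNorm (dyadicBlock v ψ n) (ENNReal.ofReal p)
      AddCircle.haarAddCircle = Q ^ (1 / p) := by
    rw [MeasureTheory.eLpNorm_eq_lintegral_rpow_enorm_toReal (by simpa using hp0)
      ENNReal.ofReal_ne_top, ENNReal.toReal_ofReal hp0.le]
  have hfin : Q ^ (1 / p) ≠ ⊤ := ENNReal.rpow_ne_top_of_nonneg (by positivity) hQ
  rw [hnorm, Real.norm_of_nonneg (by positivity),
    ← ENNReal.ofReal_rpow_of_nonneg (by positivity) hq.le, ENNReal.ofReal_mul (by positivity),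
    ENNReal.ofReal_toReal hfin, ENNReal.mul_rpow_of_nonneg _ _ hq.le, ← ENNReal.rpow_mul,
    ENNReal.ofReal_rpow_of_nonneg (by positivity) hq.le, ← Real.rpow_mul (by norm_num)]
  congr 1
  · rw [mul_assoc, one_div_mul_cancel hq.ne', mul_one, Real.rpow_natCast,
      ENNReal.ofReal_pow (by norm_num), ENNReal.ofReal_ofNat]
  · congr 1
    field_simp

/-- Each piece is a sum of three dyadic blocks of frequency comparable to `upper (k + 1)`. Since the
dyadic index is injective in `k`, each of the three shifts counts a block at most once. -/
theorem tsum_lacunary_ne_top {v : ℝ → ℝ} (hv : IsDyadicWindow v) {p : ℝ} {ψ : ℂ → ℂ}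
    (hp0 : 0 < p) (hp1 : p < 1)
    (hB : MemBesov v (1 / (p / (1 - p))) (ENNReal.ofReal p) (ENNReal.ofReal (p / (1 - p))) ψ)
    {lower upper : ℕ → ℕ} (h : IsLacunary lower upper)
    (hc : ∀ j, upper 0 ≤ j → taylorCoeff ψ j ≠ 0 →
      ∃ k, j ∈ Finset.Ico (lower k) (upper (k + 1))) :
    ∑' k, ((upper (k + 1) : ℝ≥0∞) ^ (1 - p) *
      ∫⁻ t, ‖trigPoly (taylorCoeff ψ) (Finset.Ico (lower k) (upper (k + 1))) t‖ₑ ^ p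
        ∂AddCircle.haarAddCircle) ^ (1 / (1 - p)) ≠ ⊤ := by
  have h1p : 0 < 1 - p := by linarith
  have hr : 1 ≤ 1 / (1 - p) := by rw [le_div_iff₀ h1p]; linarith
  obtain ⟨e, hinj, he⟩ := h.exists_dyadic_index
  let Q : ℕ → ℝ≥0∞ := fun n => ∫⁻ t, ‖dyadicBlock v ψ n t‖ₑ ^ p ∂AddCircle.haarAddCircle
  let g : ℕ → ℝ≥0∞ := fun n => 2 ^ n * Q n ^ (1 / (1 - p))
  let K : ℝ≥0∞ := 4 * (3 : ℝ≥0∞) ^ (1 / (1 - p) - 1)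
  have hterm : ∀ k, ((upper (k + 1) : ℝ≥0∞) ^ (1 - p) *
      ∫⁻ t, ‖trigPoly (taylorCoeff ψ) (Finset.Ico (lower k) (upper (k + 1))) t‖ₑ ^ p
        ∂AddCircle.haarAddCircle) ^ (1 / (1 - p)) ≤ K * ∑ i ∈ Finset.range 3, g (e k + i) := by
    intro k
    obtain ⟨h0, h1, h2⟩ := he k
    have hmeas : ∀ n, Measurable fun t => ‖dyadicBlock v ψ n t‖ₑ ^ p := fun n =>
      (continuous_dyadicBlock v ψ n).measurable.enorm.pow_const p
    have hint : ∫⁻ t, ‖trigPoly (taylorCoeff ψ) (Finset.Ico (lower k) (upper (k + 1))) t‖ₑ ^ p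
        ∂AddCircle.haarAddCircle ≤ ∑ i ∈ Finset.range 3, Q (e k + i) := by
      simp only [Q]
      rw [← MeasureTheory.lintegral_finsetSum _ fun i _ => hmeas _]
      refine MeasureTheory.lintegral_mono fun t => ?_
      rw [trigPoly_eq_sum_dyadicBlock hv h hc h0 h1 h2]
      refine (ENNReal.rpow_le_rpow (enorm_sum_le _ _) hp0.le).trans ?_
      have hsub := ENNReal.rpow_tsum_le_tsum_rpow hp0 hp1.le
        fun i : Finset.range 3 => ‖dyadicBlock v ψ (e k + i) t‖ₑ
      rwa [Finset.tsum_subtype (Finset.range 3) fun i => ‖dyadicBlock v ψ (e k + i) t‖ₑ,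
        Finset.tsum_subtype (Finset.range 3) fun i => ‖dyadicBlock v ψ (e k + i) t‖ₑ ^ p] at hsub
    have hup : (upper (k + 1) : ℝ≥0∞) ≤ 4 * 2 ^ e k := by
      have : upper (k + 1) ≤ 4 * 2 ^ e k := by
        rw [pow_add] at h2
        omega
      exact_mod_cast this
    rw [ENNReal.mul_rpow_of_nonneg _ _ (by positivity), ← ENNReal.rpow_mul,
      mul_one_div_cancel h1p.ne', ENNReal.rpow_one]
    calc _ ≤ (4 * 2 ^ e k) * (∑ i ∈ Finset.range 3, Q (e k + i)) ^ (1 / (1 - p)) := by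
          gcongr
      _ ≤ (4 * 2 ^ e k) * ((3 : ℝ≥0∞) ^ (1 / (1 - p) - 1) *
            ∑ i ∈ Finset.range 3, Q (e k + i) ^ (1 / (1 - p))) := by
          gcongr
          simpa using ENNReal.rpow_sum_le_const_mul_sum_rpow (Finset.range 3)
            (fun i => Q (e k + i)) hr
      _ = K * ∑ i ∈ Finset.range 3, 2 ^ e k * Q (e k + i) ^ (1 / (1 - p)) := by
          rw [← Finset.mul_sum]
          ring
      _ ≤ _ := by
          refine mul_le_mul_right (Finset.sum_le_sum fun i _ => ?_) K
          exact mul_le_mul_left (pow_le_pow_right₀ (by norm_num) (Nat.le_add_right _ _)) _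
  have hK : K ≠ ⊤ := ENNReal.mul_ne_top (by norm_num)
    (ENNReal.rpow_ne_top_of_nonneg (by linarith) (by norm_num))
  refine ne_top_of_le_ne_top ?_ (ENNReal.tsum_le_tsum hterm)
  rw [ENNReal.tsum_mul_left, Summable.tsum_finsetSum fun _ _ => ENNReal.summable]
  refine ENNReal.mul_ne_top hK (ENNReal.sum_ne_top.2 fun i _ => ?_)
  refine ne_top_of_le_ne_top (hB.tsum_ne_top hp0 hp1) ?_
  exact ENNReal.tsum_comp_le_tsum_of_injective (f := fun k => e k + i)
    ((add_left_injective i).comp hinj) g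

/-! ### Reduction to lacunary intervals -/

theorem exists_isLacunary_shift {ξ η : ℕ → ℕ} {q : ℝ} (hq : 0 < q) (hη : ∀ k, 0 < η k)
    (hξη : ∀ k, ξ k ≤ η k)
    (hsum : Summable fun k : ℕ =>
      (((η (k + 1) : ℝ) - (ξ (k + 1) : ℝ) + (η k : ℝ)) / (η (k + 1) : ℝ)) ^ q) :
    ∃ K, IsLacunary (fun k => ξ (K + k + 1)) (fun k => η (K + k)) ∧ ∀ k ≤ K, η k ≤ η K := by
  have hnn : ∀ k, 0 ≤ ((η (k + 1) : ℝ) - (ξ (k + 1) : ℝ) + (η k : ℝ)) / (η (k + 1) : ℝ) := by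
    intro k
    have : (ξ (k + 1) : ℝ) ≤ η (k + 1) := by exact_mod_cast hξη (k + 1)
    have : 0 ≤ (η (k + 1) : ℝ) - (ξ (k + 1) : ℝ) := by linarith
    positivity
  have hlim := hsum.tendsto_atTop_zero
  obtain ⟨K₀, hK₀⟩ := Filter.eventually_atTop.1
    (hlim.eventually_lt_const (show (0 : ℝ) < (1 / 8 : ℝ) ^ q by positivity))
  have hgap : ∀ k, K₀ ≤ k → 8 * (η (k + 1) + η k) < η (k + 1) + 8 * ξ (k + 1) := by
    intro k hk
    have h1 := (Real.rpow_lt_rpow_iff (hnn k) (by norm_num) hq).1 (hK₀ k hk)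
    rw [div_lt_iff₀ (by exact_mod_cast hη (k + 1))] at h1
    have h2 : (8 * (η (k + 1) + η k) : ℝ) < η (k + 1) + 8 * ξ (k + 1) := by linarith
    exact_mod_cast h2
  have hinc : ∀ k, K₀ ≤ k → η k < η (k + 1) := by
    intro k hk
    have := hgap k hk
    have := hξη (k + 1)
    omega
  have hmono : ∀ m n, K₀ ≤ m → m ≤ n → η m ≤ η n := by
    intro m n hm hmn
    induction n, hmn using Nat.le_induction with
    | base => exact le_rfl
    | succ n hmn ih => exact ih.trans (hinc n (hm.trans hmn)).le
  have hlarge : ∀ n, n ≤ η (K₀ + n) := by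
    intro n
    induction n with
    | zero => exact Nat.zero_le _
    | succ n ih =>
      have := hinc (K₀ + n) (by omega)
      rw [← add_assoc]
      omega
  -- Past `K₀` the integers `η` increase strictly, so moving on by the sum of the earlier values
  -- makes `η K` dominate them all. The early intervals then lie below `η K`, inside the finite
  -- head.
  refine ⟨K₀ + ∑ j ∈ Finset.range K₀, η j, ⟨hη _, fun k => hξη _, fun k => ?_⟩, fun k hk => ?_⟩
  · exact hgap (K₀ + ∑ j ∈ Finset.range K₀, η j + k) (by omega)
  · rcases le_or_gt K₀ k with h | h
    · exact hmono _ _ h hk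
    · refine le_trans ?_ (hlarge _)
      exact Finset.single_le_sum (f := η) (fun _ _ => Nat.zero_le _) (Finset.mem_range.2 h)

theorem theorem4 (p pSharp : ℝ) (hp0 : 0 < p) (hp1 : p < 1) (hpSharp : pSharp = p / (1 - p))
    (ξ η : ℕ → ℕ) (hξ : ∀ k, 0 < ξ k) (hη : ∀ k, 0 < η k) (hξη : ∀ k, ξ k ≤ η k)
    (hsum : Summable fun k : ℕ =>
      (((η (k + 1) : ℝ) - (ξ (k + 1) : ℝ) + (η k : ℝ)) / (η (k + 1) : ℝ)) ^ (2 / pSharp))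
    (ψ : ℂ → ℂ) (hψ : DifferentiableOn ℂ ψ (Metric.ball 0 1))
    (hsupp : ∀ j : ℕ, j ∉ ⋃ k : ℕ, Set.Ico (ξ k) (η k) → taylorCoeff ψ j = 0)
    (v : ℝ → ℝ) (hv : IsDyadicWindow v)
    (hBesov : MemBesov v (1 / pSharp) (ENNReal.ofReal p) (ENNReal.ofReal pSharp) ψ) :
    IsSchurMultiplier p (hankelMatrix ψ) := by
  subst hpSharp
  have h1p : 0 < 1 - p := by linarith
  have hq : 2 / (p / (1 - p)) = 2 * (1 - p) / p := by field_simp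
  rw [hq] at hsum
  have hqpos : 0 < 2 * (1 - p) / p := by positivity
  obtain ⟨K, hlac, hmax⟩ := exists_isLacunary_shift hqpos hη hξη hsum
  have hc : ∀ j, η (K + 0) ≤ j → taylorCoeff ψ j ≠ 0 →
      ∃ k, j ∈ Finset.Ico (ξ (K + k + 1)) (η (K + (k + 1))) := by
    intro j hj hne
    by_contra! hcon
    refine hne (hsupp j fun hmem => ?_)
    obtain ⟨k, hk⟩ := Set.mem_iUnion.1 hmem
    rw [Set.mem_Ico] at hk
    rcases le_or_gt k K with h | h
    · have := hmax k h
      rw [add_zero] at hj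
      omega
    · refine hcon (k - (K + 1)) ?_
      rw [Finset.mem_Ico, show K + (k - (K + 1)) + 1 = k by omega,
        show K + (k - (K + 1) + 1) = k by omega]
      exact hk
  have hε : ∑' k, (((η (K + (k + 1)) - ξ (K + k + 1) + η (K + k) : ℕ) : ℝ≥0∞) /
      (η (K + (k + 1)) : ℝ≥0∞)) ^ (2 * (1 - p) / p) ≠ ⊤ := by
    have h1 : Summable fun k => (((η (K + k + 1) : ℝ) - (ξ (K + k + 1) : ℝ) + (η (K + k) : ℝ)) /
        (η (K + k + 1) : ℝ)) ^ (2 * (1 - p) / p) :=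
      hsum.comp_injective (add_right_injective K)
    refine ne_of_eq_of_ne (tsum_congr fun k => ?_) h1.tsum_ofReal_ne_top
    rw [← add_assoc]
    have hpos : (0 : ℝ) < η (K + k + 1) := by exact_mod_cast hη _
    have hcast : (((η (K + k + 1) - ξ (K + k + 1) + η (K + k) : ℕ) : ℝ)) =
        (η (K + k + 1) : ℝ) - (ξ (K + k + 1) : ℝ) + (η (K + k) : ℝ) := by
      rw [Nat.cast_add, Nat.cast_sub (hξη _)]
    rw [← hcast, ← ENNReal.ofReal_rpow_of_nonneg (by positivity) hqpos.le,
      ENNReal.ofReal_div_of_pos hpos, ENNReal.ofReal_natCast, ENNReal.ofReal_natCast]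
  obtain ⟨M, hM, hS⟩ := exists_schurLE_hankel hp0 hp1 hlac hc hε
    (tsum_lacunary_ne_top hv hp0 hp1 hBesov hlac hc)
  exact hS.isSchurMultiplier hp0 hp1 hM
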